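/- **Setting.** Let $J=[n]\cup[n]^*$ with involution $i\leftrightarrow i^*$, and let $J_n$ be the set of admissible $n$-subsets $X\subset J$ (those with $X\cap X^*=\emptyset$). Let $V^{2n}$ be the real space with basis $e_j$ ($j\in J$) and symmetric form $e_i\cdot e_{i^*}=1$, $e_i\cdot e_j=0$ for $j\neq i^*$; let $V^{2n+1}=V^{2n}\oplus\mathbb R f$ with $f\cdot f=1$, $f\perp V^{2n}$. A $D_n$-representation is an $n\times 2n$ matrix $C$ (columns labelled by $J$) whose rows are a basis of a Lagrangian (totally isotropic, $n$-dimensional) subspace of $V^{2n}$. A $B_n$-representation is an $n\times(2n+1)$ matrix $(C,c)$ whose rows are a basis of an $n$-dimensional totally isotropic subspace of $V^{2n+1}$. In both cases the bases of the represented Lagrangian matroid are the $X\in J_n$ for which the minor of $C$ with columns $X$ is non-zero. **Signs.** Given a basis $F$, put $T=F\cap[n]$ and $\varepsilon_i=(-1)^{\#\{j\in T\,:\,j\le i\}}$. Swap the columns $j$ and $j^*$ of $C$ for $j\in T$ (so that the right-hand columns carry the labels $F$ and the left-hand columns the labels $F^*$), multiply the two columns in the $i$-th positions of the left and of the right half by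 $\varepsilon_i$ for every $i$, and row reduce to $(A,I_n)$ in type $D_n$, to $(A,I_n,c')$ in type $B_n$. * Type $D_n$: $A$ is skew-symmetric, and $X\in J_n$ receives the sign of the Pfaffian of the principal minor of $A$ indexed by $(X\triangle F)\cap[n]$. * Type $B_n$: $S=A+\tfrac12c'c'^T$ is skew-symmetric. For $Y\in J_n$ let $\hat Y$ be $Y\cup\{n+1\}$ or $Y\cup\{(n+1)^*\}$, whichever has an even number of unstarred elements. Then $X\in J_n$ receives the sign of the Pfaffian of the principal minor of $\begin{pmatrix}S&c'\\-c'^T&0\end{pmatrix}$ indexed by $(\hat X\triangle\hat F)\cap[n+1]$. An orientation $p:J_n\to\{+,-,0\}$ of the represented matroid is any map obtained in this way from some basis $F$, up to a global change of sign. **Constituents.** Two Lagrangian subspaces $L_1,L_2$ of $V^{2n}$ form a Lagrangian pair if $\dim(L_1\cap L_2)=n-1$. Such a pair constitutes a subspace $U\subset V^{2n+1}$ if there are $x\in L_1\setminus L_2$, $y\in L_2\setminus L_1$ and real $\alpha,\beta,t$ with $t\ne0$ and $(\alpha x)\cdot(\beta y)=-\tfrac12t^2$ such that $U=(L_1\cap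 L_2)\oplus\mathbb R(\alpha x+\beta y+tf)$. **Theorem.** Let $(C,c)$ be a $B_n$-representation with $c\neq0$, let $U$ be its row space, and let $\mathcal M$ be the represented matroid. Then $U$ is constituted by the Lagrangian pair of row spaces of some $D_n$-representations $C_1,C_2$. Moreover, for all $D_n$-representations $C_1,C_2$ whose row spaces form a Lagrangian pair constituting $U$, with represented matroids $\mathcal M_1,\mathcal M_2$: 1. the set of bases of $\mathcal M$ is the disjoint union of the sets of bases of $\mathcal M_1$ and $\mathcal M_2$; 2. for all orientations $p,p_1,p_2$ of $\mathcal M,\mathcal M_1,\mathcal M_2$ obtained from $(C,c),C_1,C_2$ respectively, there are $\epsilon_1,\epsilon_2\in\{+1,-1\}$ such that $p(X)=\epsilon_k\,p_k(X)$ for every basis $X$ of $\mathcal M_k$, $k=1,2$. -/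

import Mathlib

/-! # Oriented Lagrangian matroids represented in types `D_n` and `B_n` over `ℝ` -/

namespace BnMatroid

open scoped symmDiff

/-- The set `J = [n] ∪ [n]^*`: `Sum.inl i` is the element `i`, `Sum.inr i` is `i^*`. -/
abbrev J (n : ℕ) : Type := Fin n ⊕ Fin n

/-- The involution `j ↦ j^*` of `J`. -/
def star {n : ℕ} : J n → J n := Sum.swap

/-- A subset `X` of `J` is admissible if `X ∩ X^* = ∅`. -/
def IsAdmissible {n : ℕ} (X : Finset (J n)) : Prop := ∀ j ∈ X, star j ∉ X

/-- `J_n`: the collection of all admissible `n`-subsets of `J`. -/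
def AdmissibleSet (n : ℕ) : Type :=
  {X : Finset (J n) // IsAdmissible X ∧ X.card = n}

/-- The set `X ∩ [n]` of unstarred elements of `X`. -/
def AdmissibleSet.unstarred {n : ℕ} (X : AdmissibleSet n) : Finset (Fin n) :=
  Finset.univ.filter fun i => Sum.inl i ∈ X.1

/-! ### Subspaces and representations -/

/-- The scalar product of the orthogonal space `V^{2n}` with basis `e_j`, `j ∈ J`:
`e_i · e_{i^*} = 1`, and `e_i · e_j = 0` if `j ≠ i^*`. -/
def scalarD {n : ℕ} (u v : J n → ℝ) : ℝ := ∑ j : J n, u j * v (star j)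

/-- The scalar product of the standard orthogonal space `V^{2n+1}`, which has one more basis
vector `f`, with `f · f = 1` and `f` orthogonal to all `e_j`. -/
def scalarB {n : ℕ} (u v : (J n → ℝ) × ℝ) : ℝ := scalarD u.1 v.1 + u.2 * v.2

/-- Lagrangian subspaces of the orthogonal space `V^{2n}`. -/
def IsLagrangian {n : ℕ} (L : Submodule ℝ (J n → ℝ)) : Prop :=
  (∀ u ∈ L, ∀ v ∈ L, scalarD u v = 0) ∧ Module.finrank ℝ L = n

/-- Lagrangian pairs of subspaces: the intersection has dimension `n - 1`. -/
def IsLagrangianPair {n : ℕ} (L₁ L₂ : Submodule ℝ (J n → ℝ)) : Prop :=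
  IsLagrangian L₁ ∧ IsLagrangian L₂ ∧
    Module.finrank ℝ (L₁ ⊓ L₂ : Submodule ℝ (J n → ℝ)) + 1 = n

/-- The row space of an `n × 2n` matrix with columns indexed by `J`. -/
def rowSpaceD {n : ℕ} (C : Matrix (Fin n) (J n) ℝ) : Submodule ℝ (J n → ℝ) :=
  Submodule.span ℝ (Set.range fun r => C r)

/-- The row space of an `n × (2n+1)` matrix `(C, c)`; the columns of `C` are indexed by `J`, and
`c` is the last column. -/
def rowSpaceB {n : ℕ} (C : Matrix (Fin n) (J n) ℝ) (c : Fin n → ℝ) :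
    Submodule ℝ ((J n → ℝ) × ℝ) :=
  Submodule.span ℝ (Set.range fun r => (C r, c r))

/-- `C` is an orthogonal (type `D_n`) representation of a Lagrangian matroid: its rows form a
basis of a Lagrangian subspace of `V^{2n}`. -/
def IsDnRepresentation {n : ℕ} (C : Matrix (Fin n) (J n) ℝ) : Prop :=
  LinearIndependent ℝ (fun r => C r) ∧ ∀ r s, scalarD (C r) (C s) = 0

/-- `(C, c)` is a `B_n`-representation of a Lagrangian matroid: its rows form a basis of an
`n`-dimensional totally isotropic subspace of `V^{2n+1}`. -/
def IsBnRepresentation {n : ℕ} (C : Matrix (Fin n) (J n) ℝ) (c : Fin n → ℝ) : Prop :=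
  LinearIndependent ℝ (fun r => ((C r, c r) : (J n → ℝ) × ℝ)) ∧
    ∀ r s, scalarB (C r, c r) (C s, c s) = 0

/-- The `n × n` submatrix of `C` whose columns are those indexed by the elements of `X ∈ J_n`;
its `i`-th column is the one labelled by the element of `X` in `{i, i^*}`. -/
def columns {n : ℕ} (C : Matrix (Fin n) (J n) ℝ) (X : AdmissibleSet n) :
    Matrix (Fin n) (Fin n) ℝ :=
  Matrix.of fun r i => if i ∈ X.unstarred then C r (Sum.inl i) else C r (Sum.inr i)

/-- The same for the complementary set `X^*`. -/
def starColumns {n : ℕ} (C : Matrix (Fin n) (J n) ℝ) (X : AdmissibleSet n) :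
    Matrix (Fin n) (Fin n) ℝ :=
  Matrix.of fun r i => if i ∈ X.unstarred then C r (Sum.inr i) else C r (Sum.inl i)

/-- `X` is a basis of the Lagrangian matroid represented by `C` (type `D_n`) or by `(C, c)`
(type `B_n`): the minor with columns `X` is non-zero. -/
def IsBasis {n : ℕ} (C : Matrix (Fin n) (J n) ℝ) (X : AdmissibleSet n) : Prop :=
  (columns C X).det ≠ 0

/-- The Lagrangian pair `L₁`, `L₂` constitutes the totally isotropic subspace `U` of `V^{2n+1}`:
if `L₁`, `L₂` are the row spaces of `(A; x)` and `(A; y)`, where the rows of `A` are a basis of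
`L₁ ∩ L₂`, then `U` is the row space of `(A, 0; αx + βy, t)` for suitable scalars `α`, `β`,
`t ≠ 0` with `αx · βy = -t² / 2`. -/
def Constitutes {n : ℕ} (L₁ L₂ : Submodule ℝ (J n → ℝ)) (U : Submodule ℝ ((J n → ℝ) × ℝ)) :
    Prop :=
  IsLagrangianPair L₁ L₂ ∧
    ∃ (x y : J n → ℝ) (α β t : ℝ), x ∈ L₁ ∧ x ∉ L₂ ∧ y ∈ L₂ ∧ y ∉ L₁ ∧ t ≠ 0 ∧
      scalarD (α • x) (β • y) = -(1 / 2) * t ^ 2 ∧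
      U = (L₁ ⊓ L₂).map (LinearMap.inl ℝ (J n → ℝ) ℝ) ⊔ Submodule.span ℝ {(α • x + β • y, t)}

/-! ### Pfaffians and signs -/

/-- The Pfaffian of a `k × k` matrix: `0` for odd `k`; for `k = 2m` the sum of
`sign σ * ∏ l, a (σ (2l)) (σ (2l+1))` (indices starting at `0`) over the permutations `σ` for which
each `σ (2l)` is the least of the values `σ j`, `j ≥ 2l`. -/
noncomputable def pfaffian {k : ℕ} (A : Matrix (Fin k) (Fin k) ℝ) : ℝ :=
  open Classical in
  if Even k then
    ∑ σ ∈ Finset.univ.filter (fun σ : Equiv.Perm (Fin k) =>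
        ∀ i j : Fin k, Even (i : ℕ) → i ≤ j → σ i ≤ σ j),
      ((Equiv.Perm.sign σ : ℤ) : ℝ) *
        ∏ l : Fin (k / 2), A (σ ⟨2 * l, by omega⟩) (σ ⟨2 * l + 1, by omega⟩)
  else 0

/-- The Pfaffian of the principal minor of `A` indexed by `K`, in increasing order. -/
noncomputable def principalPfaffian {N : ℕ} (A : Matrix (Fin N) (Fin N) ℝ)
    (K : Finset (Fin N)) : ℝ :=
  pfaffian (A.submatrix (K.orderEmbOfFin rfl) (K.orderEmbOfFin rfl))

/-- The sign given to `X` by the matrix `(A, I_N)` with `A` skew-symmetric, where the columns of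
`I_N` are labelled by `F` and those of `A` by `F^*`: the sign of the Pfaffian of the principal
minor of `A` indexed by `(X ∆ F) ∩ [N]`. -/
noncomputable def skewSign {N : ℕ} (A : Matrix (Fin N) (Fin N) ℝ) (F X : AdmissibleSet N) :
    SignType :=
  SignType.sign (principalPfaffian A (X.unstarred ∆ F.unstarred))

/-- The sign `ε_i = (-1)^{#{j ∈ F ∩ [n] : j ≤ i}}` by which the columns `i` and `i^*` have been
multiplied once `j` and `j^*` have been swapped for every `j ∈ F ∩ [n]`, since each such swap
multiplies the columns `j, j^*, …, n, n^*` by `-1`. -/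
def swapSign {n : ℕ} (F : AdmissibleSet n) (i : Fin n) : ℝ :=
  (-1) ^ (F.unstarred.filter (· ≤ i)).card

/-- The inverse of the right-hand `n` columns after the swaps leading to `F`; multiplication by it
is the row operation which turns these columns into the identity matrix. -/
noncomputable def rowOperation {n : ℕ} (C : Matrix (Fin n) (J n) ℝ) (F : AdmissibleSet n) :
    Matrix (Fin n) (Fin n) ℝ :=
  (columns C F * Matrix.diagonal (swapSign F))⁻¹

/-- The left-hand `n` columns after the swaps leading to `F` and the row operation. -/
noncomputable def reducedLeft {n : ℕ} (C : Matrix (Fin n) (J n) ℝ) (F : AdmissibleSet n) :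
    Matrix (Fin n) (Fin n) ℝ :=
  rowOperation C F * (starColumns C F * Matrix.diagonal (swapSign F))

/-- The last column of `(C, c)` after the swaps leading to `F` and the row operation. -/
noncomputable def reducedLast {n : ℕ} (C : Matrix (Fin n) (J n) ℝ) (c : Fin n → ℝ)
    (F : AdmissibleSet n) : Fin n → ℝ :=
  (rowOperation C F).mulVec c

/-- An orientation of the orthogonal Lagrangian matroid represented by `C`: for some basis `F`, the
signs read off from the reduced matrix at `F`, up to a global change of sign. -/
def IsDnOrientation {n : ℕ} (C : Matrix (Fin n) (J n) ℝ) (p : AdmissibleSet n → SignType) : Prop :=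
  ∃ F : AdmissibleSet n, IsBasis C F ∧ ∃ ε : SignType, ε ≠ 0 ∧
    ∀ X, p X = ε * skewSign (reducedLeft C F) F X

/-- The inclusion of `[n] ∪ [n]^*` in `[n+1] ∪ [n+1]^*`. -/
def liftJ {n : ℕ} : J n → J (n + 1) := Sum.map Fin.castSucc Fin.castSucc

/-- The one of `n+1`, `(n+1)^*` that makes the number of unstarred elements of `X` even. -/
def extra {n : ℕ} (X : AdmissibleSet n) : J (n + 1) :=
  if Even X.unstarred.card then Sum.inr (Fin.last n) else Sum.inl (Fin.last n)

theorem liftJ_injective {n : ℕ} : Function.Injective (liftJ (n := n)) :=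
  Sum.map_injective.2 ⟨Fin.castSucc_injective n, Fin.castSucc_injective n⟩

theorem liftJ_ne_extra {n : ℕ} (j : J n) (X : AdmissibleSet n) :
    liftJ j ≠ extra X ∧ liftJ j ≠ star (extra X) := by
  unfold extra star
  rcases j with j | j <;> split_ifs <;> simp [liftJ, (Fin.castSucc_lt_last j).ne]

/-- `X ∪ {w}` with `w ∈ {n+1, (n+1)^*}` such that the number of unstarred elements is even. -/
def explode {n : ℕ} (X : AdmissibleSet n) : AdmissibleSet (n + 1) :=
  ⟨insert (extra X) (X.1.image liftJ), by
    have h1 : ∀ j : J n, star (liftJ j) = liftJ (star j) := by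
      rintro (j | j) <;> rfl
    have h2 : star (extra X) ≠ extra X := by
      unfold extra star; split_ifs <;> simp
    have h3 : ∀ j : J (n + 1), star (star j) = j := Sum.swap_swap
    refine ⟨?_, ?_⟩
    · intro j hj hs
      rw [Finset.mem_insert, Finset.mem_image] at hj hs
      rcases hj with rfl | ⟨a, ha, rfl⟩
      · rcases hs with hs | ⟨b, hb, hs⟩
        · exact h2 hs
        · exact (liftJ_ne_extra b X).2 hs
      · rcases hs with hs | ⟨b, hb, hs⟩
        · exact (liftJ_ne_extra a X).2 (by rw [← hs, h3])
        · rw [h1] at hs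
          rw [liftJ_injective hs] at hb
          exact X.2.1 a ha hb
    · rw [Finset.card_insert_of_notMem, Finset.card_image_of_injective _ liftJ_injective, X.2.2]
      rw [Finset.mem_image]
      rintro ⟨b, -, hb⟩
      exact (liftJ_ne_extra b X).1 hb⟩

/-- For a matrix `(A, I_n, c)` with isotropic row space, the skew-symmetric matrix
`(S, c; -cᵀ, 0)` of size `n + 1`, where `S = A + ½ c cᵀ`. -/
noncomputable def explodedMatrix {n : ℕ} (A : Matrix (Fin n) (Fin n) ℝ) (c : Fin n → ℝ) :
    Matrix (Fin (n + 1)) (Fin (n + 1)) ℝ :=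
  Matrix.reindex finSumFinEquiv finSumFinEquiv
    (Matrix.fromBlocks (A + (1 / 2 : ℝ) • Matrix.vecMulVec c c) (Matrix.replicateCol (Fin 1) c)
      (-Matrix.replicateRow (Fin 1) c) 0)

/-- An orientation of the Lagrangian matroid `B_n`-represented by `(C, c)`: for some basis `D`,
the signs of the corresponding bases of the exploded orthogonal Lagrangian matroid, represented by
`(S, c, I_n, 0; -cᵀ, 0, 0, 1)` with column labels `D^*, w^*, D, w`, up to a global change of
sign. -/
def IsBnOrientation {n : ℕ} (C : Matrix (Fin n) (J n) ℝ) (c : Fin n → ℝ)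
    (p : AdmissibleSet n → SignType) : Prop :=
  ∃ D : AdmissibleSet n, IsBasis C D ∧ ∃ ε : SignType, ε ≠ 0 ∧
    ∀ X, p X = ε *
      skewSign (explodedMatrix (reducedLeft C D) (reducedLast C c D)) (explode D) (explode X)

end BnMatroid

namespace BnMatroid

open scoped symmDiff

/-! ### The spin representation -/

/-! The argument replaces minors and Pfaffians by coordinates of pure spinors. Spinors are functions
on the subsets of `[n]`, and `V^{2n}` acts on them with `uv + vu = -(u · v)` (`cliff_anticomm`). An
isotropic family kills a non-zero spinor `ψ`, which can be taken of pure parity because vectors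
exchange the parities. A row `(v, s)` of type `B_n` acts as `v + κs` with `κ² = 1/2`; this is
consistent because isotropy gives `v² = -(v · v)/2 = κ²s²`.

A killed spinor knows the oriented matroid. `F` is a basis exactly when `ψ(F ∩ [n]) ≠ 0`
(`IsSpinorOf.isBasis_iff`). Translating `ψ` by `F ∩ [n]` matches the signed column swaps
(`cliff_flipVec`), and for the reduced rows the annihilation equations become the first-row
expansion of Pfaffians. Hence in type `D_n` the Pfaffian attached to a basis `X` is `ψ(X)/ψ(F)`, so
every orientation is `± sign ψ` on the bases, whatever `F` was used. In type `B_n` the same holds up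
to a positive factor, after `ψ` is extended to a spinor on `[n + 1]` which obeys the recursion of
the exploded matrix (`explodeSpinor_recursion`).

If `L₁`, `L₂` constitute `U` and `ψ₁` is the spinor of `L₁`, then a multiple `ψ₂` of `yψ₁` is a
spinor of `L₂` of the opposite parity, and the relation `(αx) · (βy) = -t²/2` says exactly that `ψ₁
+ ψ₂` is a spinor of `U`. The supports of `ψ₁` and `ψ₂` are disjoint, so both assertions follow by
reading coordinates. Existence of a constituting pair is a signature argument, using that the form
on `V^{2n}` has signature `(n, n)`. -/

theorem neg_one_pow_card_symmDiff {α : Type*} [DecidableEq α] (S T : Finset α) :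
    (-1 : ℝ) ^ (S ∆ T).card = (-1) ^ S.card * (-1) ^ T.card := by
  have h1 : (S ∆ T).card = (S \ T).card + (T \ S).card :=
    Finset.card_union_of_disjoint disjoint_sdiff_sdiff
  have h2 := Finset.card_sdiff_add_card_inter S T
  have h3 := Finset.card_sdiff_add_card_inter T S
  rw [Finset.inter_comm] at h3
  rw [h1, ← h2, ← h3, pow_add, pow_add, pow_add]
  have : ((-1 : ℝ) ^ (S ∩ T).card) * (-1) ^ (S ∩ T).card = 1 := by
    rw [← mul_pow]; norm_num
  linear_combination (-(-1 : ℝ) ^ (S \ T).card * (-1) ^ (T \ S).card) * this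

@[simp]
theorem finset_symmDiff_empty {α : Type*} [DecidableEq α] (S : Finset α) : S ∆ ∅ = S :=
  symmDiff_bot S

/-- The sign `(-1)^{#{j ∈ T : j < i}}`. -/
def sgn {n : ℕ} (i : Fin n) (T : Finset (Fin n)) : ℝ := (-1) ^ (T.filter (· < i)).card

theorem sgn_mul_self {n : ℕ} (i : Fin n) (T : Finset (Fin n)) : sgn i T * sgn i T = 1 := by
  rw [sgn, ← mul_pow]; norm_num

theorem sgn_ne_zero {n : ℕ} (i : Fin n) (T : Finset (Fin n)) : sgn i T ≠ 0 :=
  pow_ne_zero _ (by norm_num)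

theorem sgn_symmDiff {n : ℕ} (i : Fin n) (S T : Finset (Fin n)) :
    sgn i (S ∆ T) = sgn i S * sgn i T := by
  rw [sgn, sgn, sgn, ← neg_one_pow_card_symmDiff]
  congr 2
  ext j
  simp only [Finset.mem_filter, Finset.mem_symmDiff]
  tauto

theorem sgn_singleton {n : ℕ} (i j : Fin n) :
    sgn i {j} = if j < i then -1 else 1 := by
  unfold sgn
  rw [Finset.filter_singleton]
  split_ifs <;> simp

/-- Spinors: real functions on the subsets of `[n]`. -/
abbrev Spinor (n : ℕ) : Type := Finset (Fin n) → ℝ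

/-- The coefficient with which `v` toggles the element `i` of `T`. -/
def toggle {n : ℕ} (v : J n → ℝ) (i : Fin n) (T : Finset (Fin n)) : ℝ :=
  if i ∈ T then v (Sum.inl i) else -v (Sum.inr i)

/-- Clifford multiplication of spinors by vectors. -/
noncomputable def cliff {n : ℕ} : (J n → ℝ) →ₗ[ℝ] Spinor n →ₗ[ℝ] Spinor n :=
  LinearMap.mk₂ ℝ (fun v ψ T => ∑ i, sgn i T * toggle v i T * ψ (T ∆ {i}))
    (fun u v ψ => by
      ext T
      simp only [Pi.add_apply, ← Finset.sum_add_distrib]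
      refine Finset.sum_congr rfl fun i _ => ?_
      unfold toggle
      split_ifs <;> simp <;> ring)
    (fun a v ψ => by
      ext T
      simp only [Pi.smul_apply, smul_eq_mul, Finset.mul_sum]
      refine Finset.sum_congr rfl fun i _ => ?_
      unfold toggle
      split_ifs <;> simp <;> ring)
    (fun v ψ φ => by
      ext T
      simp only [Pi.add_apply, ← Finset.sum_add_distrib]
      exact Finset.sum_congr rfl fun i _ => by ring)
    (fun a v ψ => by
      ext T
      simp only [Pi.smul_apply, smul_eq_mul, Finset.mul_sum]
      exact Finset.sum_congr rfl fun i _ => by ring)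

theorem cliff_apply {n : ℕ} (v : J n → ℝ) (ψ : Spinor n) (T : Finset (Fin n)) :
    cliff v ψ T = ∑ i, sgn i T * toggle v i T * ψ (T ∆ {i}) := rfl

theorem mem_symmDiff_singleton_iff {α : Type*} [DecidableEq α] {T : Finset α} {i j : α} :
    i ∈ T ∆ {j} ↔ (i ≠ j ∧ i ∈ T) ∨ (i = j ∧ i ∉ T) := by
  simp only [Finset.mem_symmDiff, Finset.mem_singleton]
  tauto

theorem toggle_symmDiff_of_ne {n : ℕ} (v : J n → ℝ) {i j : Fin n} (h : i ≠ j)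
    (T : Finset (Fin n)) : toggle v i (T ∆ {j}) = toggle v i T := by
  unfold toggle
  simp [mem_symmDiff_singleton_iff, h]

theorem scalarD_eq_sum {n : ℕ} (u v : J n → ℝ) :
    scalarD u v = ∑ i, (u (Sum.inl i) * v (Sum.inr i) + u (Sum.inr i) * v (Sum.inl i)) := by
  simp [scalarD, star, Fintype.sum_sum_type, Finset.sum_add_distrib]

/-- Toggling `j` changes the sign attached to `i` exactly when `j < i`. For `i ≠ j` this happens in
just one of the two orders of toggling, so the mixed terms cancel; only the terms `i = j`, which
return to `T`, survive. -/
theorem cliff_anticomm {n : ℕ} (u v : J n → ℝ) (ψ : Spinor n) :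
    cliff u (cliff v ψ) + cliff v (cliff u ψ) = -(scalarD u v) • ψ := by
  ext T
  have e1 : cliff u (cliff v ψ) T = ∑ i, ∑ j,
      sgn i T * toggle u i T * (sgn j (T ∆ {i}) * toggle v j (T ∆ {i}) * ψ (T ∆ {i} ∆ {j})) := by
    simp only [cliff_apply, Finset.mul_sum]
  have e2 : cliff v (cliff u ψ) T = ∑ i, ∑ j,
      sgn j T * toggle v j T * (sgn i (T ∆ {j}) * toggle u i (T ∆ {j}) * ψ (T ∆ {j} ∆ {i})) := by
    rw [Finset.sum_comm]
    simp only [cliff_apply, Finset.mul_sum]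
  have key : ∀ i j, sgn i T * toggle u i T *
        (sgn j (T ∆ {i}) * toggle v j (T ∆ {i}) * ψ (T ∆ {i} ∆ {j})) +
      sgn j T * toggle v j T * (sgn i (T ∆ {j}) * toggle u i (T ∆ {j}) * ψ (T ∆ {j} ∆ {i})) =
      if i = j then -(u (Sum.inl i) * v (Sum.inr i) + u (Sum.inr i) * v (Sum.inl i)) * ψ T
      else 0 := by
    intro i j
    by_cases h : i = j
    · subst h
      simp only [if_true, symmDiff_symmDiff_cancel_right, sgn_symmDiff, sgn_singleton, lt_irrefl,
        if_false]
      have hs := sgn_mul_self i T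
      by_cases hi : i ∈ T
      · simp only [toggle, mem_symmDiff_singleton_iff, hi]
        simp
        linear_combination (-(u (Sum.inl i) * v (Sum.inr i) + u (Sum.inr i) * v (Sum.inl i)) * ψ T)
          * hs
      · simp only [toggle, mem_symmDiff_singleton_iff, hi]
        simp
        linear_combination (-(u (Sum.inl i) * v (Sum.inr i) + u (Sum.inr i) * v (Sum.inl i)) * ψ T)
          * hs
    · rw [if_neg h, toggle_symmDiff_of_ne u h, toggle_symmDiff_of_ne v (Ne.symm h),
        symmDiff_right_comm T {j} {i}]
      simp only [sgn_symmDiff, sgn_singleton]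
      rcases lt_or_gt_of_ne h with h' | h'
      · simp only [h', h'.not_gt, if_true, if_false]; ring
      · simp only [h', h'.not_gt, if_true, if_false]; ring
  rw [Pi.add_apply, e1, e2, ← Finset.sum_add_distrib]
  simp only [← Finset.sum_add_distrib, key, Finset.sum_ite_eq, Finset.mem_univ, if_true]
  rw [← Finset.sum_mul, Finset.sum_neg_distrib, scalarD_eq_sum]
  rfl

theorem cliff_cliff_of_eq_zero {n : ℕ} {u v : J n → ℝ} {ψ : Spinor n} (h : cliff u ψ = 0) :
    cliff u (cliff v ψ) = -(scalarD u v) • ψ := by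
  simpa [h] using cliff_anticomm u v ψ

theorem cliff_cliff_self {n : ℕ} {v : J n → ℝ} (hv : scalarD v v = 0) (ψ : Spinor n) :
    cliff v (cliff v ψ) = 0 := by
  have h := cliff_anticomm v v ψ
  rw [hv, neg_zero, zero_smul, ← two_smul ℝ] at h
  simpa using h

/-- If the new vector does not yet kill `ψ`, multiply `ψ` by it: an isotropic vector squares to
zero, and the earlier vectors, being orthogonal to it, anticommute past it. -/
theorem exists_spinor {n : ℕ} {ι : Type*} [DecidableEq ι] (v : ι → J n → ℝ)
    (hv : ∀ r s, scalarD (v r) (v s) = 0) (S : Finset ι) :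
    ∃ ψ : Spinor n, ψ ≠ 0 ∧ ∀ r ∈ S, cliff (v r) ψ = 0 := by
  induction S using Finset.induction_on with
  | empty => exact ⟨1, one_ne_zero, by simp⟩
  | insert a S _ ih =>
    obtain ⟨ψ, h0, h⟩ := ih
    by_cases ha : cliff (v a) ψ = 0
    · exact ⟨ψ, h0, by simpa [ha] using h⟩
    · refine ⟨cliff (v a) ψ, ha, fun r hr => ?_⟩
      rcases Finset.mem_insert.1 hr with rfl | hr
      · exact cliff_cliff_self (hv _ _) ψ
      · rw [cliff_cliff_of_eq_zero (h r hr), hv, neg_zero, zero_smul]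

/-- The part of a spinor supported on subsets `T` with `(-1)^#T = δ`. -/
noncomputable def parityPart {n : ℕ} (δ : ℝ) (ψ : Spinor n) : Spinor n :=
  fun T => if (-1 : ℝ) ^ T.card = δ then ψ T else 0

theorem neg_one_pow_card_symmDiff_singleton {α : Type*} [DecidableEq α] (T : Finset α) (i : α) :
    (-1 : ℝ) ^ (T ∆ {i}).card = -(-1) ^ T.card := by
  simp [neg_one_pow_card_symmDiff]

theorem cliff_parityPart {n : ℕ} (δ : ℝ) (v : J n → ℝ) (ψ : Spinor n) :
    cliff v (parityPart δ ψ) = parityPart (-δ) (cliff v ψ) := by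
  ext T
  simp only [cliff_apply, parityPart, neg_one_pow_card_symmDiff_singleton, neg_eq_iff_eq_neg]
  split_ifs <;> simp

theorem exists_homogeneous_spinor {n : ℕ} (C : Matrix (Fin n) (J n) ℝ)
    (hC : ∀ r s, scalarD (C r) (C s) = 0) :
    ∃ (ψ : Spinor n) (δ : ℝ), ψ ≠ 0 ∧ parityPart δ ψ = ψ ∧ ∀ r, cliff (C r) ψ = 0 := by
  obtain ⟨ψ, h0, h⟩ := exists_spinor (fun r => C r) hC Finset.univ
  obtain ⟨T, hT⟩ := Function.ne_iff.1 h0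
  refine ⟨parityPart ((-1) ^ T.card) ψ, (-1) ^ T.card, ?_, ?_, fun r => ?_⟩
  · exact Function.ne_iff.2 ⟨T, by simpa [parityPart] using hT⟩
  · ext S
    simp only [parityPart]
    split_ifs <;> rfl
  · rw [cliff_parityPart, h r (Finset.mem_univ r)]
    ext S
    simp [parityPart]

/-! ### Change of base point -/

/-- The sign by which the columns `i`, `i^*` are multiplied by the swaps at `F`. -/
def flipSign {n : ℕ} (F : Finset (Fin n)) (i : Fin n) : ℝ := (-1) ^ (F.filter (· ≤ i)).card

/-- The vector obtained from `v` by the swaps at `F` and the corresponding sign changes. -/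
def flipVec {n : ℕ} (F : Finset (Fin n)) (v : J n → ℝ) : J n → ℝ :=
  Sum.elim (fun i => (if i ∈ F then v (Sum.inr i) else v (Sum.inl i)) * flipSign F i)
    (fun i => (if i ∈ F then v (Sum.inl i) else v (Sum.inr i)) * flipSign F i)

theorem flipSign_eq {n : ℕ} (F : Finset (Fin n)) (i : Fin n) :
    flipSign F i = if i ∈ F then -sgn i F else sgn i F := by
  unfold flipSign sgn
  split_ifs with h
  · have : F.filter (· ≤ i) = insert i (F.filter (· < i)) := by
      ext j
      simp only [Finset.mem_filter, Finset.mem_insert, le_iff_lt_or_eq]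
      constructor
      · rintro ⟨h1, h2 | h2⟩ <;> tauto
      · rintro (rfl | h1) <;> tauto
    rw [this, Finset.card_insert_of_notMem (by simp), pow_succ]
    ring
  · congr 2
    ext j
    simp only [Finset.mem_filter, le_iff_lt_or_eq]
    constructor
    · rintro ⟨h1, h2 | rfl⟩ <;> tauto
    · tauto

/-- Exchanging `e_i` and `e_{i^*}` reverses the sign built into `toggle`. For `i ∈ F` this turns the
count of `j < i` into the count of `j ≤ i`, which is why the swap signs have that form. -/
theorem cliff_flipVec {n : ℕ} (F : Finset (Fin n)) (v : J n → ℝ) (ψ : Spinor n) :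
    cliff (flipVec F v) (fun T => ψ (F ∆ T)) = fun T => cliff v ψ (F ∆ T) := by
  ext T
  simp only [cliff_apply]
  refine Finset.sum_congr rfl fun i _ => ?_
  rw [symmDiff_assoc, sgn_symmDiff]
  simp only [toggle, flipVec, Sum.elim_inl, Sum.elim_inr, flipSign_eq, Finset.mem_symmDiff]
  congr 1
  by_cases h1 : i ∈ F <;> by_cases h2 : i ∈ T <;> simp [h1, h2] <;> ring

/-- The equation of row `i ∈ T`, evaluated at `T \ {i}`, expresses `g T` through values at sets with
fewer elements. So the value at `∅` determines everything, for any scalars `k`. -/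
theorem eq_zero_of_apply_empty {n : ℕ} (A : Matrix (Fin n) (Fin n) ℝ) (k : Fin n → ℝ)
    (g : Spinor n)
    (h : ∀ i, cliff (Sum.elim (A i) ((1 : Matrix (Fin n) (Fin n) ℝ) i)) g + k i • g = 0)
    (h0 : g ∅ = 0) : g = 0 := by
  have key : ∀ m, ∀ T : Finset (Fin n), T.card ≤ m → g T = 0 := by
    intro m
    induction m with
    | zero =>
      intro T hT
      rw [Finset.card_eq_zero.1 (Nat.le_zero.1 hT), h0]
    | succ m ih =>
      intro T hT
      rcases T.eq_empty_or_nonempty with rfl | ⟨i, hi⟩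
      · exact h0
      have hc := Finset.card_erase_of_mem hi
      have hpos := Finset.card_pos.2 ⟨i, hi⟩
      have e := congrFun (h i) (T.erase i)
      rw [Pi.add_apply, Pi.smul_apply, ih (T.erase i) (by omega), cliff_apply,
        Finset.sum_eq_single i] at e
      · have hT' : T.erase i ∆ {i} = T := by
          ext j
          simp only [mem_symmDiff_singleton_iff, Finset.mem_erase]
          by_cases hj : j = i
          · subst hj; simp [hi]
          · simp [hj]
        rw [hT'] at e
        simpa [toggle, sgn_ne_zero] using e
      · intro j _ hj
        by_cases hjT : j ∈ T.erase i
        · rw [ih _ _, mul_zero]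
          have : T.erase i ∆ {j} = (T.erase i).erase j := by
            ext l
            simp only [mem_symmDiff_singleton_iff, Finset.mem_erase]
            by_cases hl : l = j
            · subst hl; simp [hj, (Finset.mem_erase.1 hjT).2]
            · simp [hl]
          rw [this]
          exact (Finset.card_erase_le).trans (by omega)
        · simp [toggle, hjT, Ne.symm hj]
      · simp
  ext T
  exact key _ T le_rfl

/-! ### Pfaffians -/

/-- The permutation of `Fin (k + 1)` with value `j` at `0` which restricts to `σ` up to the
order isomorphism of the complements of `0` and `j`. -/
def consPerm {k : ℕ} (j : Fin (k + 1)) (σ : Equiv.Perm (Fin k)) : Equiv.Perm (Fin (k + 1)) :=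
  (Equiv.Perm.decomposeFin.symm (0, σ)).trans j.cycleRange.symm

theorem consPerm_zero {k : ℕ} (j : Fin (k + 1)) (σ : Equiv.Perm (Fin k)) :
    consPerm j σ 0 = j := by
  simp [consPerm]

theorem consPerm_succ {k : ℕ} (j : Fin (k + 1)) (σ : Equiv.Perm (Fin k)) (i : Fin k) :
    consPerm j σ i.succ = j.succAbove (σ i) := by
  simp [consPerm]

theorem sign_consPerm {k : ℕ} (j : Fin (k + 1)) (σ : Equiv.Perm (Fin k)) :
    Equiv.Perm.sign (consPerm j σ) = (-1) ^ (j : ℕ) * Equiv.Perm.sign σ := by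
  have : consPerm j σ = j.cycleRange.symm * Equiv.Perm.decomposeFin.symm (0, σ) := by
    ext; simp [consPerm]
  rw [this, Equiv.Perm.sign_mul, Equiv.Perm.sign_symm, Fin.sign_cycleRange]
  simp

theorem consPerm_injective {k : ℕ} {j j' : Fin (k + 1)} {σ σ' : Equiv.Perm (Fin k)}
    (h : consPerm j σ = consPerm j' σ') : j = j' ∧ σ = σ' := by
  have h1 : j = j' := by rw [← consPerm_zero j σ, h, consPerm_zero]
  subst h1
  refine ⟨rfl, Equiv.ext fun i => ?_⟩
  have := congrArg (fun τ => τ i.succ) h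
  simpa [consPerm_succ] using this

theorem exists_consPerm {k : ℕ} (τ : Equiv.Perm (Fin (k + 1))) :
    ∃ j σ, consPerm j σ = τ := by
  have h : ∀ i : Fin k, ∃ l, (τ 0).succAbove l = τ i.succ := fun i =>
    Fin.exists_succAbove_eq fun e => Fin.succ_ne_zero i (τ.injective e)
  choose s hs using h
  have hi : Function.Injective s := fun a b hab => by
    have : τ a.succ = τ b.succ := by rw [← hs, ← hs, hab]
    exact Fin.succ_injective _ (τ.injective this)
  refine ⟨τ 0, Equiv.ofBijective s (Finite.injective_iff_bijective.1 hi), Equiv.ext fun i => ?_⟩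
  refine Fin.cases (consPerm_zero _ _) (fun i => ?_) i
  rw [consPerm_succ]
  exact hs i

/-- The condition on permutations in the definition of the Pfaffian. -/
def IsPfaffianPerm {k : ℕ} (σ : Equiv.Perm (Fin k)) : Prop :=
  ∀ i j : Fin k, Even (i : ℕ) → i ≤ j → σ i ≤ σ j

theorem isPfaffianPerm_consPerm {k : ℕ} (j : Fin (k + 1)) (σ : Equiv.Perm (Fin k)) :
    IsPfaffianPerm (consPerm 0 (consPerm j σ)) ↔ IsPfaffianPerm σ := by
  have h0 : consPerm 0 (consPerm j σ) 0 = 0 := consPerm_zero _ _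
  have h2 : ∀ i : Fin k, consPerm 0 (consPerm j σ) i.succ.succ = (j.succAbove (σ i)).succ := by
    intro i; simp [consPerm_succ]
  constructor
  · intro h a b ha hab
    have := h a.succ.succ b.succ.succ (by simpa [Nat.even_add_one] using ha) (by simpa using hab)
    rw [h2, h2, Fin.succ_le_succ_iff] at this
    exact (Fin.strictMono_succAbove j).le_iff_le.1 this
  · intro h a b ha hab
    induction a using Fin.cases with
    | zero => rw [h0]; exact Fin.zero_le _
    | succ a =>
      induction a using Fin.cases with
      | zero => simp at ha
      | succ a =>
        induction b using Fin.cases with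
        | zero => simp at hab
        | succ b =>
          induction b using Fin.cases with
          | zero => simp [Fin.le_def] at hab
          | succ b =>
            rw [h2, h2, Fin.succ_le_succ_iff]
            exact (Fin.strictMono_succAbove j).monotone
              (h a b (by simpa [Nat.even_add_one] using ha) (by simpa using hab))

theorem exists_consPerm_of_isPfaffianPerm {k : ℕ} {τ : Equiv.Perm (Fin (k + 2))}
    (h : IsPfaffianPerm τ) : ∃ j σ, consPerm 0 (consPerm j σ) = τ := by
  obtain ⟨a, ρ, rfl⟩ := exists_consPerm τ
  obtain ⟨j, σ, rfl⟩ := exists_consPerm ρ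
  have ha : a = 0 := by
    have := h 0 ((consPerm a (consPerm j σ)).symm 0) (by simp) (Fin.zero_le _)
    rw [Equiv.apply_symm_apply, consPerm_zero] at this
    exact Fin.le_zero_iff.1 this
  exact ⟨j, σ, by rw [ha]⟩

theorem pfaffian_zero (A : Matrix (Fin 0) (Fin 0) ℝ) : pfaffian A = 1 := by
  unfold pfaffian
  rw [if_pos (by simp)]
  rw [Finset.filter_true_of_mem (fun σ _ i => i.elim0)]
  simp

/-- Expansion along the first row: an admitted permutation must fix `0`, may send `1` to any `j +
1`, and restricts to an admitted permutation of the other indices. -/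
theorem pfaffian_add_two {k : ℕ} (hk : Even k) (A : Matrix (Fin (k + 2)) (Fin (k + 2)) ℝ) :
    pfaffian A = ∑ j : Fin (k + 1), (-1) ^ (j : ℕ) * A 0 j.succ *
      pfaffian (A.submatrix (fun i => (j.succAbove i).succ) (fun i => (j.succAbove i).succ)) := by
  classical
  unfold pfaffian
  simp only [if_pos hk, if_pos (hk.add even_two), Finset.mul_sum]
  rw [Finset.sum_sigma']
  symm
  refine Finset.sum_bij (fun x _ => consPerm 0 (consPerm x.1 x.2)) ?_ ?_ ?_ ?_
  · rintro ⟨j, σ⟩ h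
    simp only [Finset.mem_sigma, Finset.mem_univ, true_and, Finset.mem_filter] at h ⊢
    exact (isPfaffianPerm_consPerm j σ).2 h
  · rintro ⟨j, σ⟩ _ ⟨j', σ'⟩ _ h
    obtain ⟨rfl, rfl⟩ := consPerm_injective (consPerm_injective h).2
    rfl
  · intro τ h
    simp only [Finset.mem_univ, true_and, Finset.mem_filter] at h
    obtain ⟨j, σ, rfl⟩ := exists_consPerm_of_isPfaffianPerm (τ := τ) h
    refine ⟨⟨j, σ⟩, ?_, rfl⟩
    simp only [Finset.mem_sigma, Finset.mem_univ, true_and, Finset.mem_filter]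
    exact (isPfaffianPerm_consPerm j σ).1 h
  · rintro ⟨j, σ⟩ _
    have hdiv : (k + 2) / 2 = k / 2 + 1 := by omega
    rw [← Equiv.prod_comp (finCongr hdiv.symm), Fin.prod_univ_succ]
    have f0 : (⟨2 * ((finCongr hdiv.symm 0 : Fin ((k + 2) / 2)) : ℕ), by simp⟩ :
        Fin (k + 2)) = 0 := by
      ext; simp
    have f1 : (⟨2 * ((finCongr hdiv.symm 0 : Fin ((k + 2) / 2)) : ℕ) + 1, by simp⟩ : Fin (k + 2))
        = Fin.succ 0 := by
      ext; simp
    have g0 : ∀ l : Fin (k / 2),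
        (⟨2 * ((finCongr hdiv.symm l.succ : Fin ((k + 2) / 2)) : ℕ), by
          simp; omega⟩ : Fin (k + 2)) = (⟨2 * l, by omega⟩ : Fin k).succ.succ := by
      intro l; ext; simp; ring
    have g1 : ∀ l : Fin (k / 2),
        (⟨2 * ((finCongr hdiv.symm l.succ : Fin ((k + 2) / 2)) : ℕ) + 1, by
          simp; omega⟩ : Fin (k + 2)) = (⟨2 * l + 1, by omega⟩ : Fin k).succ.succ := by
      intro l; ext; simp; ring
    simp only [f0, f1, g0, g1, consPerm_zero, consPerm_succ, sign_consPerm, Fin.succAbove_zero,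
      Matrix.submatrix_apply]
    simp
    ring

/-- The hypothesis, applied with `i` the least element of the set, is the first-row expansion of the
Pfaffian, so induction on the number of pairs identifies the two sides. -/
theorem pfaffian_eq_of_recursion {N : ℕ} (E : Matrix (Fin N) (Fin N) ℝ) (g : Spinor N)
    (hg : ∀ (T : Finset (Fin N)) (i : Fin N), Odd T.card → (∀ j ∈ T, i < j) →
      g (insert i T) = ∑ j ∈ T, sgn j T * E i j * g (T.erase j)) :
    ∀ (k : ℕ), Even k → ∀ f : Fin k → Fin N, StrictMono f →
      g (Finset.univ.image f) = pfaffian (E.submatrix f f) * g ∅ := by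
  intro k hk
  obtain ⟨m, rfl⟩ := even_iff_exists_two_nsmul _ |>.1 hk
  clear hk
  induction m with
  | zero => intro f _; simp [pfaffian_zero]
  | succ m ih =>
    intro f hf
    have hm : Even (2 • m) := ⟨m, two_nsmul m⟩
    have hfs : StrictMono fun j : Fin (2 • m + 1) => f j.succ := hf.comp Fin.strictMono_succ
    have e1 : Finset.univ.image f
        = insert (f 0) (Finset.univ.image fun j : Fin (2 • m + 1) => f j.succ) := by
      ext x
      simp only [Finset.mem_image, Finset.mem_insert, Finset.mem_univ, true_and]
      exact Fin.exists_fin_succ.trans (by simp [eq_comm])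
    rw [e1, hg, Finset.sum_image (fun a _ b _ h => hfs.injective h)]
    · change _ = pfaffian (k := 2 • m + 2) (E.submatrix f f) * _
      rw [pfaffian_add_two hm, Finset.sum_mul]
      refine Finset.sum_congr rfl fun j _ => ?_
      have e2 : (Finset.univ.image fun j : Fin (2 • m + 1) => f j.succ).erase (f j.succ)
          = Finset.univ.image fun i : Fin (2 • m) => f (j.succAbove i).succ := by
        ext x
        simp only [Finset.mem_image, Finset.mem_erase, Finset.mem_univ, true_and]
        constructor
        · rintro ⟨hx, a, rfl⟩
          obtain ⟨b, rfl⟩ := Fin.exists_succAbove_eq (x := a) (y := j)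
            (by rintro rfl; exact hx rfl)
          exact ⟨b, rfl⟩
        · rintro ⟨b, rfl⟩
          exact ⟨fun h => Fin.succAbove_ne j b (hfs.injective h), _, rfl⟩
      -- Exactly `j` elements of the remaining set lie below `f j.succ`, so the Clifford sign is the
      -- sign of the expansion.
      have e3 : sgn (f j.succ) (Finset.univ.image fun j : Fin (2 • m + 1) => f j.succ)
          = (-1) ^ (j : ℕ) := by
        unfold sgn
        rw [Finset.filter_image, Finset.card_image_of_injective _ hfs.injective]
        have : (Finset.univ.filter fun a : Fin (2 • m + 1) => f a.succ < f j.succ)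
            = Finset.Iio j := by
          ext a; simp [hf.lt_iff_lt]
        rw [this, Fin.card_Iio]
      rw [e2, e3, ih (fun i => f (j.succAbove i).succ) (hfs.comp (Fin.strictMono_succAbove j))]
      simp only [Matrix.submatrix_submatrix, Matrix.submatrix_apply]
      simp only [Function.comp_def]
      ring
    · rw [Finset.card_image_of_injective _ hfs.injective]
      simp
    · simp only [Finset.mem_image, Finset.mem_univ, true_and, forall_exists_index,
        forall_apply_eq_imp_iff]
      exact fun a => hf (Fin.succ_pos a)

theorem principalPfaffian_eq_of_recursion {N : ℕ} (E : Matrix (Fin N) (Fin N) ℝ) (g : Spinor N)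
    (hg : ∀ (T : Finset (Fin N)) (i : Fin N), Odd T.card → (∀ j ∈ T, i < j) →
      g (insert i T) = ∑ j ∈ T, sgn j T * E i j * g (T.erase j))
    (K : Finset (Fin N)) (hK : Even K.card) : g K = principalPfaffian E K * g ∅ := by
  have := pfaffian_eq_of_recursion E g hg K.card hK _ (K.orderEmbOfFin rfl).strictMono
  rw [Finset.image_orderEmbOfFin_univ] at this
  exact this

/-! ### Spinors of represented matroids -/

/-- The scalar by which the vector `f` of `V^{2n+1}` acts. -/
noncomputable def kappa : ℝ := √(1 / 2)

theorem kappa_mul_self : kappa * kappa = 1 / 2 := Real.mul_self_sqrt (by norm_num)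

theorem kappa_pos : 0 < kappa := Real.sqrt_pos.2 (by norm_num)

/-- The spinor `ψ` is annihilated by the rows of `(C, c)`. -/
def IsSpinorOf {n : ℕ} (C : Matrix (Fin n) (J n) ℝ) (c : Fin n → ℝ) (ψ : Spinor n) : Prop :=
  ∀ r, cliff (C r) ψ + (kappa * c r) • ψ = 0

theorem IsSpinorOf.combination {n : ℕ} {C : Matrix (Fin n) (J n) ℝ} {c : Fin n → ℝ}
    {ψ : Spinor n} (h : IsSpinorOf C c ψ) (a : Fin n → ℝ) :
    cliff (∑ s, a s • C s) ψ + (kappa * ∑ s, a s * c s) • ψ = 0 := by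
  have : ∑ s, a s • (cliff (C s) ψ + (kappa * c s) • ψ) = 0 :=
    Finset.sum_eq_zero fun s _ => by rw [h s, smul_zero]
  rw [← this]
  simp only [map_sum, map_smul, LinearMap.sum_apply, LinearMap.smul_apply, smul_add,
    Finset.sum_add_distrib, Finset.mul_sum, Finset.sum_smul, smul_smul]
  congr 1
  exact Finset.sum_congr rfl fun s _ => by congr 1; ring

/-- Links the matrix recipe to the spinor side: the reduced rows are row combinations of `C`
transported by the swap at `F`. -/
theorem flipVec_reduced {n : ℕ} (C : Matrix (Fin n) (J n) ℝ) (F : AdmissibleSet n)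
    (hF : IsBasis C F) (i : Fin n) :
    flipVec F.unstarred (∑ s, rowOperation C F i s • C s)
      = Sum.elim (reducedLeft C F i) ((1 : Matrix (Fin n) (Fin n) ℝ) i) := by
  have hdet : IsUnit (columns C F * Matrix.diagonal (swapSign F)).det := by
    rw [Matrix.det_mul, Matrix.det_diagonal]
    exact (IsUnit.mk0 _ hF).mul (IsUnit.mk0 _ (Finset.prod_ne_zero_iff.2 fun j _ =>
      pow_ne_zero _ (by norm_num)))
  have hinv : rowOperation C F * (columns C F * Matrix.diagonal (swapSign F)) = 1 :=
    Matrix.nonsing_inv_mul _ hdet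
  ext (j | j)
  · simp only [flipVec, Sum.elim_inl, reducedLeft, ← Matrix.mul_assoc, Matrix.mul_diagonal]
    simp only [Matrix.mul_apply, Finset.sum_apply, Pi.smul_apply, smul_eq_mul, starColumns,
      Matrix.of_apply]
    split_ifs <;> rfl
  · have e := congrFun (congrFun hinv i) j
    rw [Sum.elim_inr, ← e, ← Matrix.mul_assoc, Matrix.mul_diagonal]
    simp only [flipVec, Sum.elim_inr, Matrix.mul_apply, Finset.sum_apply, Pi.smul_apply, smul_eq_mul, columns,
      Matrix.of_apply]
    split_ifs <;> rfl

theorem IsSpinorOf.reduced {n : ℕ} {C : Matrix (Fin n) (J n) ℝ} {c : Fin n → ℝ}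
    {ψ : Spinor n} (h : IsSpinorOf C c ψ) {F : AdmissibleSet n} (hF : IsBasis C F) (i : Fin n) :
    cliff (Sum.elim (reducedLeft C F i) ((1 : Matrix (Fin n) (Fin n) ℝ) i))
      (fun T => ψ (F.unstarred ∆ T)) +
      (kappa * reducedLast C c F i) • (fun T => ψ (F.unstarred ∆ T)) = 0 := by
  rw [← flipVec_reduced C F hF, cliff_flipVec]
  ext T
  exact congrFun (h.combination (rowOperation C F i)) (F.unstarred ∆ T)

theorem IsSpinorOf.apply_ne_zero {n : ℕ} {C : Matrix (Fin n) (J n) ℝ} {c : Fin n → ℝ}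
    {ψ : Spinor n} (h : IsSpinorOf C c ψ) (h0 : ψ ≠ 0) {F : AdmissibleSet n} (hF : IsBasis C F) :
    ψ F.unstarred ≠ 0 := by
  intro hz
  have := eq_zero_of_apply_empty _ _ _ (h.reduced hF) (by simpa using hz)
  refine h0 (funext fun T => ?_)
  simpa using congrFun this (F.unstarred ∆ T)

/-- If the minor vanishes, a non-trivial row combination `(v, t)` has all its `F`-coordinates zero.
Isotropy then forces `t = 0`, and the equation `vψ = 0` near `F` forces `v = 0`, contradicting
independence. -/
theorem IsSpinorOf.isBasis_iff {n : ℕ} {C : Matrix (Fin n) (J n) ℝ} {c : Fin n → ℝ}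
    {ψ : Spinor n} (h : IsSpinorOf C c ψ) (h0 : ψ ≠ 0) (hC : IsBnRepresentation C c)
    (F : AdmissibleSet n) : IsBasis C F ↔ ψ F.unstarred ≠ 0 := by
  refine ⟨h.apply_ne_zero h0, fun hψ hdet => ?_⟩
  obtain ⟨a, ha0, ha⟩ := Matrix.exists_vecMul_eq_zero_iff.2 hdet
  set v : J n → ℝ := ∑ s, a s • C s with hv
  set t : ℝ := ∑ s, a s * c s with ht
  have hvF : ∀ i, (if i ∈ F.unstarred then v (Sum.inl i) else v (Sum.inr i)) = 0 := by
    intro i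
    refine Eq.trans ?_ (congrFun ha i)
    simp only [hv, Matrix.vecMul, dotProduct, columns, Matrix.of_apply, Finset.sum_apply,
      Pi.smul_apply, smul_eq_mul]
    split_ifs <;> rfl
  -- Each hyperbolic pair `{i, i^*}` contains an element of `F`, where `v` vanishes.
  have hvv : scalarD v v = 0 := by
    rw [scalarD_eq_sum]
    refine Finset.sum_eq_zero fun i _ => ?_
    have := hvF i
    split_ifs at this <;> rw [this] <;> ring
  have hsD : scalarD v v = ∑ r, ∑ s, a r * a s * scalarD (C r) (C s) := by
    simp only [hv, scalarD, Finset.sum_apply, Pi.smul_apply, smul_eq_mul, Finset.mul_sum]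
    simp only [Finset.sum_mul_sum, ← Finset.mul_sum]
    rw [Finset.sum_comm]
    refine Finset.sum_congr rfl fun r _ => ?_
    simp only [Finset.mul_sum]
    rw [Finset.sum_comm]
    exact Finset.sum_congr rfl fun s _ => Finset.sum_congr rfl fun j _ => by ring
  have ht0 : t = 0 := by
    have htt : t * t = ∑ r, ∑ s, a r * a s * (c r * c s) := by
      rw [ht, Finset.sum_mul_sum]
      exact Finset.sum_congr rfl fun s _ => Finset.sum_congr rfl fun j _ => by ring
    have : scalarD v v + t * t = 0 := by
      rw [hsD, htt]
      simp only [← Finset.sum_add_distrib]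
      refine Finset.sum_eq_zero fun r _ => Finset.sum_eq_zero fun s _ => ?_
      rw [← mul_add]
      exact mul_eq_zero_of_right _ (hC.2 r s)
    rw [hvv, zero_add] at this
    exact mul_self_eq_zero.1 this
  have hcl : cliff v ψ = 0 := by
    have := h.combination a
    rw [← hv, ← ht, ht0, mul_zero, zero_smul, add_zero] at this
    exact this
  have hv0 : v = 0 := by
    have key : ∀ i, (if i ∈ F.unstarred then v (Sum.inr i) else v (Sum.inl i)) = 0 := by
      intro i
      -- At `F ∆ {i}` every index `j ≠ i` picks an `F`-coordinate of `v`, which is zero; index `i`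
      -- picks the `F^*`-coordinate, multiplied by `± ψ(F)`.
      have e := congrFun hcl (F.unstarred ∆ {i})
      rw [cliff_apply, Finset.sum_eq_single i, symmDiff_symmDiff_cancel_right] at e
      · have := (mul_eq_zero.1 e).resolve_right hψ
        have := (mul_eq_zero.1 this).resolve_left (sgn_ne_zero _ _)
        by_cases hi : i ∈ F.unstarred <;>
          simpa [toggle, mem_symmDiff_singleton_iff, hi] using this
      · intro j _ hj
        have := hvF j
        rw [toggle_symmDiff_of_ne v hj]
        by_cases hi : j ∈ F.unstarred
        · rw [if_pos hi] at this; simp [toggle, hi, this]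
        · rw [if_neg hi] at this; simp [toggle, hi, this]
      · simp
    ext (i | i)
    · have h1 := hvF i
      have h2 := key i
      split_ifs at h1 h2 <;> assumption
    · have h1 := hvF i
      have h2 := key i
      split_ifs at h1 h2 <;> assumption
  refine ha0 (funext fun r => ?_)
  refine Fintype.linearIndependent_iff.1 hC.1 a ?_ r
  ext1
  · simpa [hv, Prod.fst_sum] using hv0
  · simpa [ht, Prod.snd_sum] using ht0

theorem cliff_elim_zero {n : ℕ} (a : Fin n → ℝ) (g : Spinor n) (T : Finset (Fin n)) :
    cliff (Sum.elim a 0) g T = ∑ j ∈ T, sgn j T * a j * g (T.erase j) := by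
  rw [cliff_apply, ← Finset.sum_subset (Finset.subset_univ T)]
  · refine Finset.sum_congr rfl fun j hj => ?_
    have : T ∆ {j} = T.erase j := by
      ext l
      simp only [mem_symmDiff_singleton_iff, Finset.mem_erase]
      by_cases hl : l = j
      · subst hl; simp [hj]
      · simp [hl]
    rw [this]
    simp [toggle, hj]
  · intro j _ hj
    simp [toggle, hj]

/-- With `i` below all of `T`, the identity block only inserts `i`, with trivial sign. Setting this
to zero gives the Pfaffian recursion. -/
theorem cliff_elim_one {n : ℕ} (a : Fin n → ℝ) (g : Spinor n) {T : Finset (Fin n)} {i : Fin n}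
    (hi : ∀ j ∈ T, i < j) :
    cliff (Sum.elim a ((1 : Matrix (Fin n) (Fin n) ℝ) i)) g T =
      (∑ j ∈ T, sgn j T * a j * g (T.erase j)) - g (insert i T) := by
  have hiT : i ∉ T := fun h => lt_irrefl _ (hi i h)
  have e : Sum.elim a ((1 : Matrix (Fin n) (Fin n) ℝ) i)
      = Sum.elim a 0 + Sum.elim (0 : Fin n → ℝ) ((1 : Matrix (Fin n) (Fin n) ℝ) i) := by
    ext (j | j) <;> simp
  rw [e, map_add, LinearMap.add_apply, Pi.add_apply, cliff_elim_zero, sub_eq_add_neg]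
  congr 1
  rw [cliff_apply, Finset.sum_eq_single i]
  · have h1 : T ∆ {i} = insert i T := by
      ext l
      simp only [mem_symmDiff_singleton_iff, Finset.mem_insert]
      by_cases hl : l = i
      · subst hl; simp [hiT]
      · simp [hl]
    have h2 : sgn i T = 1 := by
      have : T.filter (· < i) = ∅ :=
        Finset.filter_eq_empty_iff.2 fun j hj => (hi j hj).not_gt
      simp [sgn, this]
    rw [h1, h2]
    simp [toggle, hiT]
  · intro j _ hj
    simp [toggle, Ne.symm hj]
  · simp

/-! ### Orientations in type `D_n` -/

theorem even_card_symmDiff {n : ℕ} {δ : ℝ} {ψ : Spinor n} (hψ : parityPart δ ψ = ψ)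
    {S T : Finset (Fin n)} (hS : ψ S ≠ 0) (hT : ψ T ≠ 0) : Even (S ∆ T).card := by
  have key : ∀ {S}, ψ S ≠ 0 → (-1 : ℝ) ^ S.card = δ := by
    intro S hS
    by_contra hne
    apply hS
    rw [← hψ]
    simp [parityPart, hne]
  have h1 : (-1 : ℝ) ^ (S ∆ T).card = 1 := by
    rw [neg_one_pow_card_symmDiff, key hS, ← key hT, ← mul_pow]
    norm_num
  by_contra hodd
  rw [(Nat.not_even_iff_odd.1 hodd).neg_one_pow] at h1
  norm_num at h1

theorem sign_eq_of_mul_eq {a b c d : ℝ} (ha : 0 < a) (hd : d ≠ 0) (h : a * b = c * d) :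
    SignType.sign c = SignType.sign d * SignType.sign b := by
  have h' : a * (d * b) = c * (d * d) := by linear_combination d * h
  have := congrArg SignType.sign h'
  rw [sign_mul, sign_mul, sign_mul, sign_pos ha, sign_pos (mul_self_pos.2 hd)] at this
  simpa using this.symm

/-- The recursion gives `ψ(X) = Pf · ψ(F)`. The restriction to `ψ(X) ≠ 0`, together with pure
parity, guarantees that the index set of the Pfaffian is even. -/
theorem IsDnOrientation.exists_eq_sign {n : ℕ} {C : Matrix (Fin n) (J n) ℝ}
    {p : AdmissibleSet n → SignType} (hp : IsDnOrientation C p) {ψ : Spinor n} {δ : ℝ}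
    (h : IsSpinorOf C 0 ψ) (h0 : ψ ≠ 0) (hψ : parityPart δ ψ = ψ) :
    ∃ ε : SignType, ε ≠ 0 ∧
      ∀ X, ψ X.unstarred ≠ 0 → p X = ε * SignType.sign (ψ X.unstarred) := by
  obtain ⟨F, hF, ε, hε, hp⟩ := hp
  have hψF := h.apply_ne_zero h0 hF
  refine ⟨ε * SignType.sign (ψ F.unstarred),
    mul_ne_zero hε (sign_ne_zero.2 hψF), fun X hX => ?_⟩
  have hrec := principalPfaffian_eq_of_recursion (reducedLeft C F)
    (fun T => ψ (F.unstarred ∆ T)) (fun T i _ hi => by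
      have e := congrFun (h.reduced hF i) T
      have hl : reducedLast C 0 F i = 0 := by simp [reducedLast]
      rw [hl, Pi.add_apply, cliff_elim_one _ _ hi] at e
      simp only [mul_zero, zero_smul, Pi.zero_apply, add_zero] at e
      linarith) (X.unstarred ∆ F.unstarred) (even_card_symmDiff hψ hX hψF)
  rw [symmDiff_comm X.unstarred, symmDiff_symmDiff_cancel_left,
    finset_symmDiff_empty] at hrec
  rw [hp, mul_assoc, skewSign, symmDiff_comm X.unstarred]
  congr 1
  refine sign_eq_of_mul_eq one_pos hψF ?_
  simpa using hrec

/-! ### Orientations in type `B_n` -/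

theorem parityPart_smul {n : ℕ} (δ a : ℝ) (ψ : Spinor n) :
    parityPart δ (a • ψ) = a • parityPart δ ψ := by
  ext T
  simp [parityPart]

theorem parityPart_one_add_neg_one {n : ℕ} (ψ : Spinor n) :
    parityPart 1 ψ + parityPart (-1) ψ = ψ := by
  ext T
  simp only [Pi.add_apply, parityPart]
  rcases neg_one_pow_eq_or ℝ T.card with h | h <;> rw [h] <;> norm_num

theorem scalarD_elim {n : ℕ} (a b : Fin n → ℝ) (i : Fin n) :
    scalarD (Sum.elim a ((1 : Matrix (Fin n) (Fin n) ℝ) i)) (Sum.elim b 0) = b i := by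
  simp [scalarD_eq_sum, Matrix.one_apply]

/-- The spinor of the exploded Lagrangian subspace is annihilated by its last row. -/
theorem cliff_elim_last {n : ℕ} (A : Matrix (Fin n) (Fin n) ℝ) (c : Fin n → ℝ) (g : Spinor n)
    (h : ∀ i, cliff (Sum.elim (A i) ((1 : Matrix (Fin n) (Fin n) ℝ) i)) g + (kappa * c i) • g = 0) :
    cliff (Sum.elim c 0) g = (2 * kappa) • parityPart (-1) g := by
  -- By anticommutation the difference of the two sides satisfies the row equations with `κ c_i`
  -- replaced by its negative, and it vanishes at `∅`.
  refine sub_eq_zero.1 (eq_zero_of_apply_empty A (fun i => -(kappa * c i)) _ (fun i => ?_) ?_)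
  · set v := Sum.elim (A i) ((1 : Matrix (Fin n) (Fin n) ℝ) i) with hv
    have h1 : cliff v g = -((kappa * c i) • g) := eq_neg_of_add_eq_zero_left (h i)
    have h2 := cliff_anticomm v (Sum.elim c 0) g
    have h3 : cliff v (parityPart (-1) g) = -(kappa * c i) • parityPart 1 g := by
      rw [cliff_parityPart, h1, neg_neg, ← neg_smul, parityPart_smul]
    have h4 := parityPart_one_add_neg_one g
    rw [h1, hv, scalarD_elim, ← hv, map_neg, map_smul] at h2
    rw [map_sub, map_smul, h3]
    ext T
    have h2' := congrFun h2 T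
    have h4' := congrFun h4 T
    simp only [Pi.add_apply, Pi.sub_apply, Pi.smul_apply, Pi.neg_apply, smul_eq_mul,
      Pi.zero_apply] at h2' h4' ⊢
    linear_combination h2' + c i * h4' +
      2 * c i * (parityPart 1 g T + parityPart (-1) g T) * kappa_mul_self
  · simp only [Pi.sub_apply, cliff_elim_zero, Pi.smul_apply, parityPart]
    norm_num

/-! ### Passing from `[n]` to `[n + 1]` -/

/-- The elements of `K ⊆ [n + 1]` in `[n]`. -/
def lowerPart {n : ℕ} (K : Finset (Fin (n + 1))) : Finset (Fin n) :=
  Finset.univ.filter fun i => i.castSucc ∈ K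

theorem mem_lowerPart {n : ℕ} {K : Finset (Fin (n + 1))} {i : Fin n} :
    i ∈ lowerPart K ↔ i.castSucc ∈ K := by
  simp [lowerPart]

theorem card_filter_eq_lowerPart {n : ℕ} (K : Finset (Fin (n + 1))) (P : Fin (n + 1) → Prop)
    [DecidablePred P] (hP : ¬ P (Fin.last n)) :
    (K.filter P).card = ((lowerPart K).filter fun j => P j.castSucc).card := by
  rw [← Finset.card_image_of_injective _ (Fin.castSucc_injective n)]
  congr 1
  ext j
  induction j using Fin.lastCases with
  | last => simp [hP]
  | cast j => simp [mem_lowerPart]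

theorem sum_eq_sum_lowerPart {n : ℕ} (K : Finset (Fin (n + 1))) (F : Fin (n + 1) → ℝ) :
    ∑ j ∈ K, F j = (∑ j ∈ lowerPart K, F j.castSucc) +
      if Fin.last n ∈ K then F (Fin.last n) else 0 := by
  rw [show ∑ j ∈ K, F j = ∑ j, if j ∈ K then F j else 0 by simp,
    Fin.sum_univ_castSucc]
  congr 1
  rw [lowerPart, Finset.sum_filter]

theorem sgn_castSucc {n : ℕ} (K : Finset (Fin (n + 1))) (j : Fin n) :
    sgn j.castSucc K = sgn j (lowerPart K) := by
  unfold sgn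
  rw [card_filter_eq_lowerPart _ _ (Fin.castSucc_lt_last j).not_gt]
  simp

theorem sgn_last {n : ℕ} (K : Finset (Fin (n + 1))) :
    sgn (Fin.last n) K = (-1) ^ (lowerPart K).card := by
  unfold sgn
  rw [card_filter_eq_lowerPart K (· < Fin.last n) (lt_irrefl _)]
  simp [Fin.castSucc_lt_last]

theorem card_eq_card_lowerPart {n : ℕ} (K : Finset (Fin (n + 1))) :
    K.card = (lowerPart K).card + if Fin.last n ∈ K then 1 else 0 := by
  have := sum_eq_sum_lowerPart K fun _ => 1
  simp only [Finset.sum_const, nsmul_eq_mul, mul_one] at this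
  split_ifs at this ⊢ <;> exact_mod_cast this

theorem lowerPart_insert {n : ℕ} (K : Finset (Fin (n + 1))) (i : Fin n) :
    lowerPart (insert i.castSucc K) = insert i (lowerPart K) := by
  ext j; simp [mem_lowerPart]

theorem lowerPart_erase {n : ℕ} (K : Finset (Fin (n + 1))) (i : Fin n) :
    lowerPart (K.erase i.castSucc) = (lowerPart K).erase i := by
  ext j; simp [mem_lowerPart]

theorem lowerPart_erase_last {n : ℕ} (K : Finset (Fin (n + 1))) :
    lowerPart (K.erase (Fin.last n)) = lowerPart K := by
  ext j; simp [mem_lowerPart, (Fin.castSucc_lt_last j).ne]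

theorem explodedMatrix_castSucc {n : ℕ} (A : Matrix (Fin n) (Fin n) ℝ) (c : Fin n → ℝ)
    (i j : Fin n) :
    explodedMatrix A c i.castSucc j.castSucc = A i j + 1 / 2 * (c i * c j) := by
  simp [explodedMatrix, Matrix.vecMulVec_apply]

theorem explodedMatrix_last {n : ℕ} (A : Matrix (Fin n) (Fin n) ℝ) (c : Fin n → ℝ)
    (i : Fin n) : explodedMatrix A c i.castSucc (Fin.last n) = c i := by
  simp [explodedMatrix]

/-- The spinor on `[n + 1]` obtained from a spinor on `[n]`. -/
noncomputable def explodeSpinor {n : ℕ} (g : Spinor n) : Spinor (n + 1) :=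
  fun K => (if Fin.last n ∈ K then 2 * kappa else 1) * g (lowerPart K)

/-- By `cliff_elim_last`, the correction `½ccᵀ` in the exploded matrix contributes a multiple of the
odd part of `g`, and the column `c` supplies the even part. Together they account for the scalar
term `κ c_i g` of the row equation; this fixes the weight `2κ`. -/
theorem explodeSpinor_recursion {n : ℕ} (A : Matrix (Fin n) (Fin n) ℝ) (c : Fin n → ℝ)
    (g : Spinor n)
    (h : ∀ i, cliff (Sum.elim (A i) ((1 : Matrix (Fin n) (Fin n) ℝ) i)) g + (kappa * c i) • g = 0)
    (T : Finset (Fin (n + 1))) (i : Fin (n + 1)) (hT : Odd T.card) (hi : ∀ j ∈ T, i < j) :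
    explodeSpinor g (insert i T) =
      ∑ j ∈ T, sgn j T * explodedMatrix A c i j * explodeSpinor g (T.erase j) := by
  induction i using Fin.lastCases with
  -- Vacuous: nothing lies above the last index, and `T` is non-empty.
  | last =>
    obtain ⟨j, hj⟩ := Finset.card_pos.1 hT.pos
    exact absurd (hi j hj) (Fin.le_last j).not_gt
  | cast i =>
    have hi' : ∀ j ∈ lowerPart T, i < j := fun j hj => hi _ (mem_lowerPart.1 hj)
    have e1 := congrFun (h i) (lowerPart T)
    have e2 := congrFun (cliff_elim_last A c g h) (lowerPart T)
    rw [Pi.add_apply, cliff_elim_one _ _ hi'] at e1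
    rw [cliff_elim_zero] at e2
    simp only [Pi.smul_apply, smul_eq_mul, Pi.zero_apply, parityPart] at e1 e2
    rw [sum_eq_sum_lowerPart]
    simp only [explodeSpinor, sgn_castSucc, explodedMatrix_castSucc, explodedMatrix_last,
      lowerPart_insert, lowerPart_erase, lowerPart_erase_last, Finset.mem_insert, Finset.mem_erase,
      (Fin.castSucc_lt_last _).ne', false_or, ne_eq, not_false_eq_true, true_and, not_true_eq_false,
      false_and, if_false, one_mul]
    have split : ∀ l : ℝ, ∑ j ∈ lowerPart T, sgn j (lowerPart T) * (A i j + 1 / 2 * (c i * c j)) *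
        (l * g ((lowerPart T).erase j)) =
        l * (∑ j ∈ lowerPart T, sgn j (lowerPart T) * A i j * g ((lowerPart T).erase j)) +
        l * (1 / 2 * c i) *
          ∑ j ∈ lowerPart T, sgn j (lowerPart T) * c j * g ((lowerPart T).erase j) := by
      intro l
      rw [Finset.mul_sum, Finset.mul_sum, ← Finset.sum_add_distrib]
      exact Finset.sum_congr rfl fun j _ => by ring
    have hcard := card_eq_card_lowerPart T
    rw [split, sgn_last, e2]
    -- If `n + 1 ∈ T` the lower part is even, so the odd part vanishes there and the last column
    -- gives `c_i = 2κ · κ c_i`. Otherwise the lower part is odd and the correction gives `κ c_i`.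
    by_cases hl : Fin.last n ∈ T
    · have hev : Even (lowerPart T).card := by
        rw [if_pos hl] at hcard
        rw [hcard] at hT
        by_contra hc
        exact (Nat.not_even_iff_odd.2 hT) ((Nat.not_even_iff_odd.1 hc).add_one)
      simp only [hl, if_true, hev.neg_one_pow]
      norm_num
      linear_combination (-2 * kappa) * e1 + 2 * c i * g (lowerPart T) * kappa_mul_self
    · have hodd : Odd (lowerPart T).card := by
        rw [if_neg hl, add_zero] at hcard
        rwa [hcard] at hT
      simp only [hl, if_false, hodd.neg_one_pow, if_true]
      linear_combination -e1

theorem mem_unstarred {n : ℕ} {X : AdmissibleSet n} {i : Fin n} :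
    i ∈ X.unstarred ↔ Sum.inl i ∈ X.1 := by
  simp [AdmissibleSet.unstarred]

theorem lowerPart_explode {n : ℕ} (X : AdmissibleSet n) :
    lowerPart (explode X).unstarred = X.unstarred := by
  ext i
  rw [mem_lowerPart, mem_unstarred, mem_unstarred]
  change _ ∈ insert (extra X) (X.1.image liftJ) ↔ _
  have h1 : Sum.inl i.castSucc ≠ extra X := (liftJ_ne_extra (Sum.inl i) X).1
  have h2 : (Sum.inl i.castSucc : J (n + 1)) = liftJ (Sum.inl i) := rfl
  rw [Finset.mem_insert, or_iff_right h1, h2, liftJ_injective.mem_finset_image]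

theorem last_mem_explode {n : ℕ} (X : AdmissibleSet n) :
    Fin.last n ∈ (explode X).unstarred ↔ ¬ Even X.unstarred.card := by
  rw [mem_unstarred]
  change _ ∈ insert (extra X) (X.1.image liftJ) ↔ _
  have h : (Sum.inl (Fin.last n) : J (n + 1)) ∉ X.1.image liftJ := by
    rw [Finset.mem_image]
    rintro ⟨j | j, -, hj⟩
    · exact (Fin.castSucc_lt_last j).ne (Sum.inl_injective hj)
    · cases hj
  rw [Finset.mem_insert, or_iff_left h, extra]
  split_ifs with he <;> simp [he]

theorem even_card_explode {n : ℕ} (X : AdmissibleSet n) : Even (explode X).unstarred.card := by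
  rw [card_eq_card_lowerPart, lowerPart_explode]
  simp only [last_mem_explode]
  by_cases h : Even X.unstarred.card
  · simp [h]
  · simpa [h] using (Nat.not_even_iff_odd.1 h).add_one

theorem lowerPart_symmDiff {n : ℕ} (K L : Finset (Fin (n + 1))) :
    lowerPart (K ∆ L) = lowerPart K ∆ lowerPart L := by
  ext j; simp [mem_lowerPart, Finset.mem_symmDiff]

theorem even_card_symmDiff_of_even {α : Type*} [DecidableEq α] {S T : Finset α}
    (hS : Even S.card) (hT : Even T.card) : Even (S ∆ T).card := by
  have h := neg_one_pow_card_symmDiff S T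
  rw [hS.neg_one_pow, hT.neg_one_pow] at h
  by_contra hodd
  rw [(Nat.not_even_iff_odd.1 hodd).neg_one_pow] at h
  norm_num at h

theorem IsBnOrientation.exists_eq_sign {n : ℕ} {C : Matrix (Fin n) (J n) ℝ} {c : Fin n → ℝ}
    {p : AdmissibleSet n → SignType} (hp : IsBnOrientation C c p) {ψ : Spinor n}
    (h : IsSpinorOf C c ψ) (h0 : ψ ≠ 0) :
    ∃ ε : SignType, ε ≠ 0 ∧ ∀ X, p X = ε * SignType.sign (ψ X.unstarred) := by
  obtain ⟨F, hF, ε, hε, hp⟩ := hp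
  have hψF := h.apply_ne_zero h0 hF
  refine ⟨ε * SignType.sign (ψ F.unstarred),
    mul_ne_zero hε (sign_ne_zero.2 hψF), fun X => ?_⟩
  have hrec := principalPfaffian_eq_of_recursion _ _
    (explodeSpinor_recursion _ _ _ (h.reduced hF))
    ((explode X).unstarred ∆ (explode F).unstarred)
    (even_card_symmDiff_of_even (even_card_explode X) (even_card_explode F))
  simp only [explodeSpinor, lowerPart_symmDiff, lowerPart_explode] at hrec
  rw [symmDiff_comm X.unstarred, symmDiff_symmDiff_cancel_left] at hrec
  rw [hp, mul_assoc, skewSign]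
  congr 1
  -- The weight `1` or `2κ` of the exploded spinor is positive, so it does not affect the sign.
  refine sign_eq_of_mul_eq ?_ hψF (hrec.trans ?_)
  · have := kappa_pos
    split_ifs <;> positivity
  · have : lowerPart (∅ : Finset (Fin (n + 1))) = ∅ := by ext; simp [mem_lowerPart]
    simp [this]

/-! ### Constituents -/

theorem scalarD_comm {n : ℕ} (u v : J n → ℝ) : scalarD u v = scalarD v u := by
  rw [scalarD_eq_sum, scalarD_eq_sum]
  exact Finset.sum_congr rfl fun i _ => by ring

theorem scalarD_add_left {n : ℕ} (u v w : J n → ℝ) :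
    scalarD (u + v) w = scalarD u w + scalarD v w := by
  simp [scalarD, add_mul, Finset.sum_add_distrib]

theorem scalarD_smul_left {n : ℕ} (a : ℝ) (u w : J n → ℝ) :
    scalarD (a • u) w = a * scalarD u w := by
  simp only [scalarD, Finset.mul_sum, Pi.smul_apply, smul_eq_mul, mul_assoc]

theorem scalarD_add_right {n : ℕ} (u v w : J n → ℝ) :
    scalarD u (v + w) = scalarD u v + scalarD u w := by
  rw [scalarD_comm, scalarD_add_left, scalarD_comm v, scalarD_comm w]

theorem scalarD_smul_right {n : ℕ} (a : ℝ) (u w : J n → ℝ) :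
    scalarD u (a • w) = a * scalarD u w := by
  rw [scalarD_comm, scalarD_smul_left, scalarD_comm]

/-- The scalar product with `u` as a linear form. -/
noncomputable def scalarForm {n : ℕ} : (J n → ℝ) →ₗ[ℝ] (J n → ℝ) →ₗ[ℝ] ℝ :=
  LinearMap.mk₂ ℝ scalarD scalarD_add_left scalarD_smul_left scalarD_add_right scalarD_smul_right

/-- The action of `V^{2n+1}` on a spinor. -/
noncomputable def spinAction {n : ℕ} (ψ : Spinor n) : (J n → ℝ) × ℝ →ₗ[ℝ] Spinor n :=
  (cliff.flip ψ).comp (LinearMap.fst ℝ _ _) +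
    (kappa • LinearMap.snd ℝ (J n → ℝ) ℝ).smulRight ψ

theorem spinAction_apply {n : ℕ} (ψ : Spinor n) (u : (J n → ℝ) × ℝ) :
    spinAction ψ u = cliff u.1 ψ + (kappa * u.2) • ψ := rfl

theorem isSpinorOf_iff {n : ℕ} {C : Matrix (Fin n) (J n) ℝ} {c : Fin n → ℝ} {ψ : Spinor n} :
    IsSpinorOf C c ψ ↔ rowSpaceB C c ≤ LinearMap.ker (spinAction ψ) := by
  rw [rowSpaceB, Submodule.span_le]
  constructor
  · rintro h _ ⟨r, rfl⟩
    exact h r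
  · exact fun h r => h ⟨r, rfl⟩

theorem isSpinorOf_zero_iff {n : ℕ} {C : Matrix (Fin n) (J n) ℝ} {ψ : Spinor n} :
    IsSpinorOf C 0 ψ ↔ rowSpaceD C ≤ LinearMap.ker (cliff.flip ψ) := by
  rw [rowSpaceD, Submodule.span_le]
  constructor
  · rintro h _ ⟨r, rfl⟩
    simpa using h r
  · intro h r
    have : cliff (C r) ψ = 0 := h ⟨r, rfl⟩
    simpa using this

theorem IsDnRepresentation.isBnRepresentation {n : ℕ} {C : Matrix (Fin n) (J n) ℝ}
    (hC : IsDnRepresentation C) : IsBnRepresentation C 0 := by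
  refine ⟨?_, fun r s => by simp [scalarB, hC.2 r s]⟩
  exact LinearIndependent.of_comp (LinearMap.fst ℝ (J n → ℝ) ℝ) hC.1

theorem IsLagrangianPair.eq_sup {n : ℕ} {L₁ L₂ : Submodule ℝ (J n → ℝ)}
    (h : IsLagrangianPair L₁ L₂) {y : J n → ℝ} (hy : y ∈ L₂) (hy' : y ∉ L₁) :
    L₁ ⊓ L₂ ⊔ Submodule.span ℝ {y} = L₂ := by
  refine Submodule.eq_of_le_of_finrank_le
    (sup_le inf_le_right ((Submodule.span_singleton_le_iff_mem _ _).2 hy)) ?_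
  have hlt : L₁ ⊓ L₂ < L₁ ⊓ L₂ ⊔ Submodule.span ℝ {y} := by
    refine lt_of_le_of_ne le_sup_left fun e => hy' ?_
    have : y ∈ L₁ ⊓ L₂ := by
      rw [e]
      exact Submodule.mem_sup_right (Submodule.mem_span_singleton_self y)
    exact this.1
  have := Submodule.finrank_lt_finrank_of_lt hlt
  have h1 := h.2.1.2
  have h2 := h.2.2
  omega

/-- The spinor of a subspace constituted by a Lagrangian pair is the sum of spinors of the two
Lagrangian subspaces, of opposite parities. -/
theorem Constitutes.exists_spinors {n : ℕ} {C C₁ C₂ : Matrix (Fin n) (J n) ℝ} {c : Fin n → ℝ}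
    (h₁ : IsDnRepresentation C₁)
    (h : Constitutes (rowSpaceD C₁) (rowSpaceD C₂) (rowSpaceB C c)) :
    ∃ (ψ₁ ψ₂ : Spinor n) (δ : ℝ), δ ≠ 0 ∧ ψ₁ ≠ 0 ∧ ψ₂ ≠ 0 ∧
      parityPart δ ψ₁ = ψ₁ ∧ parityPart (-δ) ψ₂ = ψ₂ ∧
      IsSpinorOf C₁ 0 ψ₁ ∧ IsSpinorOf C₂ 0 ψ₂ ∧ IsSpinorOf C c (ψ₁ + ψ₂) := by
  obtain ⟨hL, x, y, α, β, t, hx, -, hy, hy', ht, hxy, hU⟩ := h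
  obtain ⟨ψ, δ, h0, hδ, hψ⟩ := exists_homogeneous_spinor C₁ h₁.2
  have hδ0 : δ ≠ 0 := by
    rintro rfl
    apply h0
    rw [← hδ]
    ext T
    simp [parityPart]
  have hψ₁ : IsSpinorOf C₁ 0 ψ := fun r => by simp [hψ r]
  have hker : ∀ u ∈ rowSpaceD C₁, cliff u ψ = 0 := fun u hu => isSpinorOf_zero_iff.1 hψ₁ hu
  rw [scalarD_smul_left, scalarD_smul_right] at hxy
  have ht2 : t ^ 2 ≠ 0 := pow_ne_zero _ ht
  have hβ : β ≠ 0 := by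
    rintro rfl
    apply ht2
    linarith
  have hk : kappa ≠ 0 := kappa_pos.ne'
  -- Forced by cancelling the `yψ` terms in `(αx + βy + κt)(ψ + μyψ)`; the `ψ` terms then cancel
  -- exactly because `αβ(x · y) = -t²/2`.
  set μ : ℝ := -β / (kappa * t) with hμ
  have hμ0 : μ ≠ 0 := div_ne_zero (neg_ne_zero.2 hβ) (mul_ne_zero hk ht)
  have hyy : scalarD y y = 0 := hL.2.1.1 y hy y hy
  have hxψ : cliff x (cliff y ψ) = -(scalarD x y) • ψ := cliff_cliff_of_eq_zero (hker x hx)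
  have hker₂ : ∀ u ∈ rowSpaceD C₁ ⊓ rowSpaceD C₂, cliff u (cliff y ψ) = 0 := fun u hu => by
    rw [cliff_cliff_of_eq_zero (hker u hu.1), hL.2.1.1 u hu.2 y hy, neg_zero, zero_smul]
  have hψ₂ : rowSpaceD C₂ ≤ LinearMap.ker (cliff.flip (μ • cliff y ψ)) := by
    rw [← hL.eq_sup hy hy', sup_le_iff, Submodule.span_singleton_le_iff_mem]
    refine ⟨fun u hu => ?_, ?_⟩
    · rw [LinearMap.mem_ker, LinearMap.flip_apply, map_smul, hker₂ u hu, smul_zero]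
    · rw [LinearMap.mem_ker, LinearMap.flip_apply, map_smul, cliff_cliff_self hyy, smul_zero]
  refine ⟨ψ, μ • cliff y ψ, δ, hδ0, h0, ?_, hδ, ?_, hψ₁, isSpinorOf_zero_iff.2 hψ₂, ?_⟩
  -- `x(yψ) = -(x · y)ψ` with `x · y ≠ 0`, so `yψ` cannot vanish.
  · refine smul_ne_zero hμ0 fun hz => ?_
    rw [hz, map_zero] at hxψ
    have : scalarD x y = 0 := by
      simpa [h0] using hxψ.symm
    rw [this] at hxy
    apply ht2
    linarith
  · rw [parityPart_smul, ← cliff_parityPart, hδ]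
  · rw [isSpinorOf_iff, hU, sup_le_iff, Submodule.map_le_iff_le_comap,
      Submodule.span_singleton_le_iff_mem]
    refine ⟨fun u hu => ?_, ?_⟩
    · rw [Submodule.mem_comap, LinearMap.mem_ker, spinAction_apply]
      simp [hker u hu.1, hker₂ u hu]
    · rw [LinearMap.mem_ker, spinAction_apply]
      simp only [map_add, map_smul, LinearMap.add_apply, LinearMap.smul_apply, hker x hx,
        cliff_cliff_self hyy, hxψ]
      ext T
      simp only [Pi.add_apply, Pi.smul_apply, smul_eq_mul, Pi.zero_apply]
      have e1 : μ * (kappa * t) = -β := div_mul_cancel₀ _ (mul_ne_zero hk ht)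
      have e2 : α * μ * -scalarD x y + kappa * t = 0 := by
        apply mul_right_cancel₀ (mul_ne_zero hk ht)
        linear_combination (-α * scalarD x y) * e1 + hxy + t ^ 2 * kappa_mul_self
      linear_combination ψ T * e2 + (cliff y ψ T) * e1

/-! ### Existence of a constituting Lagrangian pair -/

theorem exists_isDnRepresentation {n : ℕ} {L : Submodule ℝ (J n → ℝ)} (hL : IsLagrangian L) :
    ∃ C : Matrix (Fin n) (J n) ℝ, IsDnRepresentation C ∧ rowSpaceD C = L := by
  let b := Module.finBasisOfFinrankEq ℝ L hL.2
  refine ⟨fun r => (b r : J n → ℝ), ⟨?_, fun r s => hL.1 _ (b r).2 _ (b s).2⟩, ?_⟩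
  · exact b.linearIndependent.map' L.subtype L.ker_subtype
  · have := congrArg (Submodule.map L.subtype) b.span_eq
    rw [Submodule.map_span, ← Set.range_comp, Submodule.map_top, Submodule.range_subtype] at this
    exact this

/-- A negative semidefinite subspace has dimension at most `n`. -/
theorem finrank_le_of_nonpos {n : ℕ} (Q : Submodule ℝ (J n → ℝ))
    (hQ : ∀ q ∈ Q, scalarD q q ≤ 0) : Module.finrank ℝ Q ≤ n := by
  -- On the kernel of `f` the form is `2 Σ q_i²`, hence positive definite, so a negative
  -- semidefinite subspace meets that kernel only in zero.
  let f : (J n → ℝ) →ₗ[ℝ] (Fin n → ℝ) :=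
    { toFun := fun v i => v (Sum.inl i) - v (Sum.inr i)
      map_add' := fun u v => by ext; simp; ring
      map_smul' := fun a v => by ext; simp; ring }
  have hf : Function.Injective (f.comp Q.subtype) := by
    rw [injective_iff_map_eq_zero]
    rintro ⟨q, hq⟩ h
    have he : ∀ i, q (Sum.inl i) = q (Sum.inr i) := fun i => sub_eq_zero.1 (congrFun h i)
    have h1 := hQ q hq
    have h2 : ∑ i : Fin n, 2 * (q (Sum.inr i) * q (Sum.inr i)) = 0 := by
      refine le_antisymm ?_ (Finset.sum_nonneg fun i _ =>
        mul_nonneg zero_le_two (mul_self_nonneg _))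
      refine le_trans (le_of_eq ?_) h1
      rw [scalarD_eq_sum]
      exact Finset.sum_congr rfl fun i _ => by rw [he]; ring
    have h3 := (Finset.sum_eq_zero_iff_of_nonneg fun i _ =>
      mul_nonneg zero_le_two (mul_self_nonneg (q (Sum.inr i)))).1 h2
    have h4 : ∀ i, q (Sum.inr i) = 0 := fun i => by simpa using h3 i (Finset.mem_univ i)
    ext (i | i)
    · exact (he i).trans (h4 i)
    · exact h4 i
  simpa using LinearMap.finrank_le_finrank_of_injective hf

/-- A vector of positive square orthogonal to an isotropic subspace of `V^{2n+1}`. -/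
theorem exists_pos_orthogonal {n : ℕ} {C : Matrix (Fin n) (J n) ℝ} {x : J n → ℝ}
    (hx : x ∈ rowSpaceD C) (hxx : scalarD x x < 0) :
    ∃ z, (∀ u ∈ rowSpaceD C, scalarD u z = 0) ∧ 0 < scalarD z z := by
  let f : (J n → ℝ) →ₗ[ℝ] (Fin n → ℝ) := LinearMap.pi fun r => scalarForm (C r)
  have hf : ∀ z ∈ LinearMap.ker f, ∀ u ∈ rowSpaceD C, scalarD u z = 0 := by
    intro z hz u hu
    have : rowSpaceD C ≤ LinearMap.ker (scalarForm.flip z) := by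
      rw [rowSpaceD, Submodule.span_le]
      rintro _ ⟨r, rfl⟩
      exact congrFun hz r
    exact this hu
  have hdim : n ≤ Module.finrank ℝ (LinearMap.ker f) := by
    have h1 := f.finrank_range_add_finrank_ker
    have h2 := (LinearMap.range f).finrank_le
    simp only [Module.finrank_fintype_fun_eq_card, Fintype.card_sum, Fintype.card_fin] at h1 h2
    omega
  by_contra! hneg
  -- The complement of the row space has dimension at least `n`. Were it negative semidefinite,
  -- adjoining the orthogonal negative vector `x` would give a negative semidefinite subspace of
  -- dimension above `n`.
  have hQ : ∀ q ∈ LinearMap.ker f ⊔ Submodule.span ℝ {x}, scalarD q q ≤ 0 := by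
    intro q hq
    obtain ⟨z, hz, w, hw, rfl⟩ := Submodule.mem_sup.1 hq
    obtain ⟨a, rfl⟩ := Submodule.mem_span_singleton.1 hw
    have h1 := hf z hz x hx
    have h2 := hneg z (hf z hz)
    simp only [scalarD_add_left, scalarD_add_right, scalarD_smul_left, scalarD_smul_right,
      scalarD_comm z x, h1]
    nlinarith [mul_nonneg (mul_self_nonneg a) (neg_nonneg.2 hxx.le)]
  have hlt : LinearMap.ker f < LinearMap.ker f ⊔ Submodule.span ℝ {x} := by
    refine lt_of_le_of_ne le_sup_left fun e => hxx.ne ?_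
    refine hf x ?_ x hx
    rw [e]
    exact Submodule.mem_sup_right (Submodule.mem_span_singleton_self x)
  have h1 := Submodule.finrank_lt_finrank_of_lt hlt
  have h2 := finrank_le_of_nonpos _ hQ
  omega

theorem isLagrangian_sup {n : ℕ} {W : Submodule ℝ (J n → ℝ)}
    (hW : ∀ u ∈ W, ∀ v ∈ W, scalarD u v = 0) (hdim : Module.finrank ℝ W + 1 = n)
    {x : J n → ℝ} (hx : x ∉ W) (hxx : scalarD x x = 0) (hxW : ∀ u ∈ W, scalarD u x = 0) :
    IsLagrangian (W ⊔ Submodule.span ℝ {x}) := by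
  constructor
  · intro u hu v hv
    obtain ⟨u, huW, u', hu', rfl⟩ := Submodule.mem_sup.1 hu
    obtain ⟨v, hvW, v', hv', rfl⟩ := Submodule.mem_sup.1 hv
    obtain ⟨a, rfl⟩ := Submodule.mem_span_singleton.1 hu'
    obtain ⟨b, rfl⟩ := Submodule.mem_span_singleton.1 hv'
    simp [scalarD_add_left, scalarD_add_right, scalarD_smul_left, scalarD_smul_right,
      scalarD_comm x v, hW u huW v hvW, hxx, hxW u huW, hxW v hvW]
  · have h0 : x ≠ 0 := by rintro rfl; exact hx W.zero_mem
    have hd : W ⊓ Submodule.span ℝ {x} = ⊥ :=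
      ((Submodule.disjoint_span_singleton' h0).2 hx).eq_bot
    have := Submodule.finrank_sup_add_finrank_inf_eq W (Submodule.span ℝ {x})
    rw [hd, finrank_bot, finrank_span_singleton h0] at this
    omega

theorem scalarB_eq_zero_of_mem {n : ℕ} {C : Matrix (Fin n) (J n) ℝ} {c : Fin n → ℝ}
    (hC : IsBnRepresentation C c) {u v : (J n → ℝ) × ℝ} (hu : u ∈ rowSpaceB C c)
    (hv : v ∈ rowSpaceB C c) : scalarB u v = 0 := by
  let B : (J n → ℝ) × ℝ →ₗ[ℝ] (J n → ℝ) × ℝ →ₗ[ℝ] ℝ :=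
    LinearMap.mk₂ ℝ scalarB
      (fun u v w => by simp [scalarB, scalarD_add_left]; ring)
      (fun a u w => by simp [scalarB, scalarD_smul_left]; ring)
      (fun u v w => by simp [scalarB, scalarD_add_right]; ring)
      (fun a u w => by simp [scalarB, scalarD_smul_right]; ring)
  have h1 : ∀ r, rowSpaceB C c ≤ LinearMap.ker (B (C r, c r)) := fun r => by
    rw [rowSpaceB, Submodule.span_le]
    rintro _ ⟨s, rfl⟩
    exact hC.2 r s
  have h2 : rowSpaceB C c ≤ LinearMap.ker (B.flip v) := by
    rw [rowSpaceB, Submodule.span_le]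
    rintro _ ⟨r, rfl⟩
    exact h1 r hv
  exact h2 hu

theorem exists_constitutes {n : ℕ} {C : Matrix (Fin n) (J n) ℝ} {c : Fin n → ℝ}
    (hC : IsBnRepresentation C c) (hc : c ≠ 0) :
    ∃ C₁ C₂ : Matrix (Fin n) (J n) ℝ, IsDnRepresentation C₁ ∧ IsDnRepresentation C₂ ∧
      Constitutes (rowSpaceD C₁) (rowSpaceD C₂) (rowSpaceB C c) := by
  obtain ⟨r, hr⟩ := Function.ne_iff.1 hc
  set U := rowSpaceB C c with hU
  have hrU : (C r, c r) ∈ U := Submodule.subset_span ⟨r, rfl⟩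
  set x₀ := C r with hx₀
  set t := c r with ht
  have ht0 : t ≠ 0 := hr
  have hxx : scalarD x₀ x₀ = -t ^ 2 := by
    have : scalarD x₀ x₀ + t * t = 0 := hC.2 r r
    linarith
  have hx₀C : x₀ ∈ rowSpaceD C := Submodule.subset_span ⟨r, rfl⟩
  have htpos : 0 < t ^ 2 := by positivity
  obtain ⟨z', hz', hzpos⟩ := exists_pos_orthogonal hx₀C (by rw [hxx]; linarith)
  -- Rescaled so that `z · z = -(x₀ · x₀)`, which makes `x₀ ± z` isotropic.
  obtain ⟨z, hz, hzz⟩ : ∃ z, (∀ u ∈ rowSpaceD C, scalarD u z = 0) ∧ scalarD z z = t ^ 2 := by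
    refine ⟨(t / √(scalarD z' z')) • z', fun u hu => ?_, ?_⟩
    · rw [scalarD_smul_right, hz' u hu, mul_zero]
    · rw [scalarD_smul_right, scalarD_smul_left]
      have h1 := Real.mul_self_sqrt hzpos.le
      have h2 := (Real.sqrt_pos.2 hzpos).ne'
      field_simp
      rw [sq (√(scalarD z' z')), h1]
  set W := U.comap (LinearMap.inl ℝ (J n → ℝ) ℝ) with hW
  have hWU : ∀ w ∈ W, (w, (0 : ℝ)) ∈ U := fun w hw => hw
  have hUC : ∀ u ∈ U, u.1 ∈ rowSpaceD C := by
    have : U ≤ (rowSpaceD C).comap (LinearMap.fst ℝ (J n → ℝ) ℝ) := by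
      rw [hU, rowSpaceB, Submodule.span_le]
      rintro _ ⟨s, rfl⟩
      exact Submodule.subset_span ⟨s, rfl⟩
    exact fun u hu => this hu
  have hWW : ∀ u ∈ W, ∀ v ∈ W, scalarD u v = 0 := fun u hu v hv => by
    simpa [scalarB] using scalarB_eq_zero_of_mem hC (hWU u hu) (hWU v hv)
  have hWx : ∀ u ∈ W, scalarD u x₀ = 0 := fun u hu => by
    simpa [scalarB] using scalarB_eq_zero_of_mem hC (hWU u hu) hrU
  have hWz : ∀ u ∈ W, scalarD u z = 0 := fun u hu => hz u (hUC _ (hWU u hu))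
  have hdec : U = W.map (LinearMap.inl ℝ (J n → ℝ) ℝ) ⊔ Submodule.span ℝ {(x₀, t)} := by
    refine le_antisymm (fun u hu => ?_) (sup_le ?_ ?_)
    · have h1 : u - (u.2 / t) • (x₀, t) ∈ U := U.sub_mem hu (U.smul_mem _ hrU)
      have h2 : u - (u.2 / t) • (x₀, t) = (u.1 - (u.2 / t) • x₀, (0 : ℝ)) := by
        ext1
        · rfl
        · simp [div_mul_cancel₀ _ ht0]
      rw [h2] at h1
      refine Submodule.mem_sup.2 ⟨_, Submodule.mem_map_of_mem (f := LinearMap.inl ℝ (J n → ℝ) ℝ) h1,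
        (u.2 / t) • (x₀, t), Submodule.smul_mem _ _ (Submodule.mem_span_singleton_self _), ?_⟩
      exact (congrArg (· + (u.2 / t) • (x₀, t)) h2.symm).trans (sub_add_cancel _ _)
    · exact Submodule.map_comap_le _ _
    · exact (Submodule.span_singleton_le_iff_mem _ _).2 hrU
  have hdim : Module.finrank ℝ W + 1 = n := by
    have h1 : Module.finrank ℝ U = n := by
      rw [hU, rowSpaceB, finrank_span_eq_card hC.1, Fintype.card_fin]
    have hne : (x₀, t) ≠ 0 := fun e => ht0 (congrArg Prod.snd e)
    have hd : W.map (LinearMap.inl ℝ (J n → ℝ) ℝ) ⊓ Submodule.span ℝ {(x₀, t)} = ⊥ := by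
      refine ((Submodule.disjoint_span_singleton' hne).2 ?_).eq_bot
      rintro ⟨w, -, e⟩
      exact ht0 (congrArg Prod.snd e).symm
    have h2 := Submodule.finrank_sup_add_finrank_inf_eq
      (W.map (LinearMap.inl ℝ (J n → ℝ) ℝ)) (Submodule.span ℝ {(x₀, t)})
    rw [hd, finrank_bot, finrank_span_singleton hne, ← hdec, h1,
      (Submodule.equivMapOfInjective _ LinearMap.inl_injective W).symm.finrank_eq] at h2
    omega
  -- The two isotropic directions of the hyperbolic plane spanned by `x₀` and `z`; they sum to `x₀`,
  -- so `α = β = 1` will serve.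
  set x := (1 / 2 : ℝ) • (x₀ + z) with hx
  set y := (1 / 2 : ℝ) • (x₀ + (-1 : ℝ) • z) with hy
  have hxz := hz x₀ hx₀C
  have hzx : scalarD z x₀ = 0 := by rw [scalarD_comm, hxz]
  have sxx : scalarD x x = 0 := by
    simp only [hx, scalarD_add_left, scalarD_add_right, scalarD_smul_left, scalarD_smul_right,
      hxz, hzx, hxx, hzz]
    ring
  have syy : scalarD y y = 0 := by
    simp only [hy, scalarD_add_left, scalarD_add_right, scalarD_smul_left, scalarD_smul_right,
      hxz, hzx, hxx, hzz]
    ring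
  have sxy : scalarD x y = -(1 / 2) * t ^ 2 := by
    simp only [hx, hy, scalarD_add_left, scalarD_add_right, scalarD_smul_left, scalarD_smul_right,
      hxz, hzx, hxx, hzz]
    ring
  have sxy0 : scalarD x y ≠ 0 := by rw [sxy]; linarith
  have hWx' : ∀ u ∈ W, scalarD u x = 0 := fun u hu => by
    simp [hx, scalarD_add_right, scalarD_smul_right, hWx u hu, hWz u hu]
  have hWy' : ∀ u ∈ W, scalarD u y = 0 := fun u hu => by
    simp only [hy, scalarD_add_right, scalarD_smul_right, hWx u hu, hWz u hu, mul_zero, add_zero]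
  have hxW : x ∉ W := fun h => sxy0 (hWy' x h)
  have hyW : y ∉ W := fun h => sxy0 (by rw [scalarD_comm]; exact hWx' y h)
  have L₁ := isLagrangian_sup hWW hdim hxW sxx hWx'
  have L₂ := isLagrangian_sup hWW hdim hyW syy hWy'
  have hx1 : x ∈ W ⊔ Submodule.span ℝ {x} :=
    Submodule.mem_sup_right (Submodule.mem_span_singleton_self x)
  have hy2 : y ∈ W ⊔ Submodule.span ℝ {y} :=
    Submodule.mem_sup_right (Submodule.mem_span_singleton_self y)
  have hinf : (W ⊔ Submodule.span ℝ {x}) ⊓ (W ⊔ Submodule.span ℝ {y}) = W := by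
    refine le_antisymm ?_ (le_inf le_sup_left le_sup_left)
    rintro u ⟨hu, hu'⟩
    -- Pairing `u = w + ax` with `y` leaves `a(x · y)`, so `a = 0`.
    have h1 := L₂.1 u hu' y hy2
    obtain ⟨w, hw, w', hw', rfl⟩ := Submodule.mem_sup.1 hu
    obtain ⟨a, rfl⟩ := Submodule.mem_span_singleton.1 hw'
    rw [scalarD_add_left, hWy' w hw, zero_add, scalarD_smul_left] at h1
    rw [(mul_eq_zero.1 h1).resolve_right sxy0, zero_smul, add_zero]
    exact hw
  obtain ⟨C₁, hC₁, e₁⟩ := exists_isDnRepresentation L₁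
  obtain ⟨C₂, hC₂, e₂⟩ := exists_isDnRepresentation L₂
  refine ⟨C₁, C₂, hC₁, hC₂, ?_⟩
  rw [e₁, e₂]
  refine ⟨⟨L₁, L₂, by rw [hinf, hdim]⟩, x, y, 1, 1, t, hx1, fun h => sxy0 (L₂.1 x h y hy2), hy2,
    fun h => sxy0 (L₁.1 x hx1 y h), ht0, by rw [one_smul, one_smul, sxy], ?_⟩
  have hsum : (1 : ℝ) • x + (1 : ℝ) • y = x₀ := by
    rw [hx, hy]
    module
  rw [hinf, hsum, ← hdec]

/-! ### Comparison of the bases and signs -/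

theorem disjoint_of_parityPart {n : ℕ} {δ : ℝ} (hδ : δ ≠ 0) {ψ₁ ψ₂ : Spinor n}
    (h₁ : parityPart δ ψ₁ = ψ₁) (h₂ : parityPart (-δ) ψ₂ = ψ₂) (T : Finset (Fin n)) :
    ψ₁ T = 0 ∨ ψ₂ T = 0 := by
  rw [← h₁, ← h₂]
  simp only [parityPart]
  by_cases h : (-1 : ℝ) ^ T.card = δ
  · right
    rw [if_neg]
    rw [h]
    exact (self_ne_neg.2 hδ)
  · left
    rw [if_neg h]

/-- Non-zero signs are their own inverses, so two maps that agree with `s` up to a sign agree with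
each other up to the product of the signs. -/
theorem exists_sign_eq_mul {α : Type*} {p q s : α → SignType} {P : α → Prop}
    (hp : ∃ ε : SignType, ε ≠ 0 ∧ ∀ X, P X → p X = ε * s X)
    (hq : ∃ ε : SignType, ε ≠ 0 ∧ ∀ X, P X → q X = ε * s X) :
    ∃ ε : SignType, ε ≠ 0 ∧ ∀ X, P X → p X = ε * q X := by
  obtain ⟨ε, hε, hp⟩ := hp
  obtain ⟨ε', hε', hq⟩ := hq
  refine ⟨ε * ε', mul_ne_zero hε hε', fun X hX => ?_⟩
  rw [hp X hX, hq X hX]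
  generalize s X = a
  clear hp hq
  revert ε ε' a
  decide

end BnMatroid

theorem mainTheorem6 (n : ℕ) (C : Matrix (Fin n) (BnMatroid.J n) ℝ) (c : Fin n → ℝ)
    (hC : BnMatroid.IsBnRepresentation C c) (hc : c ≠ 0) :
    (∃ C₁ C₂ : Matrix (Fin n) (BnMatroid.J n) ℝ,
      BnMatroid.IsDnRepresentation C₁ ∧ BnMatroid.IsDnRepresentation C₂ ∧
      BnMatroid.Constitutes (BnMatroid.rowSpaceD C₁) (BnMatroid.rowSpaceD C₂)
        (BnMatroid.rowSpaceB C c)) ∧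
    ∀ C₁ C₂ : Matrix (Fin n) (BnMatroid.J n) ℝ,
      BnMatroid.IsDnRepresentation C₁ → BnMatroid.IsDnRepresentation C₂ →
      BnMatroid.Constitutes (BnMatroid.rowSpaceD C₁) (BnMatroid.rowSpaceD C₂)
        (BnMatroid.rowSpaceB C c) →
      (∀ X : BnMatroid.AdmissibleSet n,
        (BnMatroid.IsBasis C X ↔ BnMatroid.IsBasis C₁ X ∨ BnMatroid.IsBasis C₂ X) ∧
        ¬ (BnMatroid.IsBasis C₁ X ∧ BnMatroid.IsBasis C₂ X)) ∧
      ∀ p p₁ p₂ : BnMatroid.AdmissibleSet n → SignType,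
        BnMatroid.IsBnOrientation C c p →
        BnMatroid.IsDnOrientation C₁ p₁ → BnMatroid.IsDnOrientation C₂ p₂ →
        ∃ ε₁ ε₂ : SignType, ε₁ ≠ 0 ∧ ε₂ ≠ 0 ∧
          (∀ X, BnMatroid.IsBasis C₁ X → p X = ε₁ * p₁ X) ∧
          (∀ X, BnMatroid.IsBasis C₂ X → p X = ε₂ * p₂ X) := by
  refine ⟨BnMatroid.exists_constitutes hC hc, fun C₁ C₂ h₁ h₂ h => ?_⟩
  obtain ⟨ψ₁, ψ₂, δ, hδ, hψ₁, hψ₂, hp₁, hp₂, hs₁, hs₂, hs⟩ := h.exists_spinors h₁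
  have hdisj := BnMatroid.disjoint_of_parityPart hδ hp₁ hp₂
  have hψ : ψ₁ + ψ₂ ≠ 0 := by
    obtain ⟨T, hT⟩ := Function.ne_iff.1 hψ₁
    refine Function.ne_iff.2 ⟨T, ?_⟩
    simpa [(hdisj T).resolve_left hT] using hT
  have hb := hs.isBasis_iff hψ hC
  have hb₁ := hs₁.isBasis_iff hψ₁ h₁.isBnRepresentation
  have hb₂ := hs₂.isBasis_iff hψ₂ h₂.isBnRepresentation
  refine ⟨fun X => ?_, fun p p₁ p₂ hp hp₁' hp₂' => ?_⟩
  · rw [hb, hb₁, hb₂, Pi.add_apply]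
    rcases hdisj X.unstarred with h | h <;> simp [h]
  · obtain ⟨ε, hε, hp⟩ := hp.exists_eq_sign hs hψ
    have key₁ := BnMatroid.exists_sign_eq_mul (p := p) ⟨ε, hε, fun X hX => by
      rw [hp, Pi.add_apply, (hdisj _).resolve_left hX, add_zero]⟩ (hp₁'.exists_eq_sign hs₁ hψ₁ hp₁)
    have key₂ := BnMatroid.exists_sign_eq_mul (p := p) ⟨ε, hε, fun X hX => by
      rw [hp, Pi.add_apply, (hdisj _).resolve_right hX, zero_add]⟩ (hp₂'.exists_eq_sign hs₂ hψ₂ hp₂)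
    obtain ⟨ε₁, hε₁, k₁⟩ := key₁
    obtain ⟨ε₂, hε₂, k₂⟩ := key₂
    exact ⟨ε₁, ε₂, hε₁, hε₂, fun X hX => k₁ X ((hb₁ X).1 hX), fun X hX => k₂ X ((hb₂ X).1 hX)⟩
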